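/- For a meromorphic function $y$ on $\mathbb{C}$ let $T(r,y)$ be its Nevanlinna characteristic. For a meromorphic function $f$ on $\mathbb{C}$ let $\mathcal{S}_0$ be the set of meromorphic functions $y$ on $\mathbb{C}$ that have only finitely many poles and are small functions of $f$, i.e. $T(r,y)=o(T(r,f))$ as $r\to\infty$ outside some set $E\subset(0,\infty)$ of finite measure. **Theorem.** Let $m\le n$, $q$ and $k$ be non-negative integers, and let $f$ be a transcendental (i.e. non-rational) meromorphic function on $\mathbb{C}$ with finitely many poles. Let $$P(z,w)=\sum_{j=m}^{n} b_j(z)\,w^j,\qquad b_m\not\equiv 0,$$ with $b_m,\dots,b_n\in\mathcal{S}_0$, and let $$L(z,w)=\sum_{|I|=0}^{k} a_I(z)\,w^{i_0}(w')^{i_1}\cdots (w^{(q)})^{i_q}$$ be a differential polynomial with all $a_I\in\mathcal{S}_0$, where the sum is over the multi-indices $I=(i_0,\dots,i_q)\in\mathbb{Z}_{\ge 0}^{q+1}$ of length $|I|=i_0+\cdots+i_q\le k$. Suppose that $L(z,f)\not\equiv 0$ and $m\ge k+2$. Then the meromorphic function $P(z,f)+L(z,f)$ is not identically zero and has infinitely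 many zeros in $\mathbb{C}$. -/

import Mathlib

open Filter Asymptotics MeasureTheory Set

namespace NevanlinnaSmall

/-! Meromorphic functions on the complex plane are total functions `ℂ → ℂ` satisfying `Meromorphic`;
their values on a discrete closed set are immaterial. Hence identities between them are understood
as equality on a codiscrete set, and zeros and poles are read off from `meromorphicOrderAt`. -/

/-- `f` and `g` are the same meromorphic function on the plane. -/
def SameMero (f g : ℂ → ℂ) : Prop := f =ᶠ[codiscrete ℂ] g

/-- The set of poles of a meromorphic function. -/
noncomputable def poleSet (f : ℂ → ℂ) : Set ℂ := {z | meromorphicOrderAt f z < 0}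

/-- The set of zeros of a meromorphic function: points of positive finite order.
(The order is `⊤` exactly where the function vanishes identically near the point,
so this set is empty for the function that is identically zero.) -/
noncomputable def zeroSet (f : ℂ → ℂ) : Set ℂ :=
  {z | 0 < meromorphicOrderAt f z ∧ meromorphicOrderAt f z ≠ ⊤}

/-- `f` is a rational function. -/
def IsRationalFunction (f : ℂ → ℂ) : Prop :=
  ∃ p q : Polynomial ℂ, q ≠ 0 ∧ SameMero f (fun z => p.eval z / q.eval z)

/-- `f` is a transcendental meromorphic function on the plane. -/
def IsTranscendentalMeromorphic (f : ℂ → ℂ) : Prop :=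
  Meromorphic f ∧ ¬ IsRationalFunction f

/-- The Nevanlinna characteristic `T(r, f) = m(r, f) + N(r, f)`. -/
noncomputable def nevT (f : ℂ → ℂ) : ℝ → ℝ := ValueDistribution.characteristic f ⊤

/-- `y` is a small function of `f`: it is meromorphic and `T(r, y) = o(T(r, f))` as `r → ∞`
outside a set `E ⊆ (0, ∞)` of finite measure. -/
def IsSmallFunction (f y : ℂ → ℂ) : Prop :=
  Meromorphic y ∧
    ∃ E : Set ℝ, E ⊆ Ioi 0 ∧ volume E < ⊤ ∧ nevT y =o[atTop ⊓ 𝓟 Eᶜ] nevT f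

/-- The class of meromorphic functions on the plane with finitely many poles. -/
def ClassN0 : Set (ℂ → ℂ) := {y | Meromorphic y ∧ (poleSet y).Finite}

/-- The class of small functions of `f` with finitely many poles. -/
def ClassS0 (f : ℂ → ℂ) : Set (ℂ → ℂ) := {y | IsSmallFunction f y} ∩ ClassN0

/-- `P(z, f) = ∑_{j=m}^n b_j(z) f(z)^j`. -/
noncomputable def polyAt (m n : ℕ) (b : ℕ → ℂ → ℂ) (f : ℂ → ℂ) : ℂ → ℂ :=
  fun z => ∑ j ∈ Finset.Icc m n, b j z * f z ^ j

/-- `L(z, f) = ∑_{|I| ≤ k} a_I(z) f^{i_0} (f')^{i_1} ⋯ (f^{(q)})^{i_q}`, the sum being over all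
multi-indices `I = (i_0, …, i_q)` of length `|I| = i_0 + ⋯ + i_q = 0, …, k`. -/
noncomputable def diffPolyAt (q k : ℕ) (a : (Fin (q + 1) → ℕ) → ℂ → ℂ) (f : ℂ → ℂ) : ℂ → ℂ :=
  fun z => ∑ d ∈ Finset.range (k + 1),
    ∑ I ∈ Finset.piAntidiag (Finset.univ : Finset (Fin (q + 1))) d,
      a I z * ∏ i : Fin (q + 1), iteratedDeriv (i : ℕ) f z ^ I i

end NevanlinnaSmall

/-!
Write `P = f ^ m * R` with `R = ∑ b_j f ^ (j - m)`, and suppose that `F = P + L` has only finitely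
many zeros. By the lemma on the logarithmic derivative `φ = F' / F` is a small function of `f` with
finitely many poles, and eliminating `F` from `F' = φ F` gives

  `f ^ (m - 1) * Q = φ L - L'`,  where  `Q = m f' R + f R' - φ f R`.

The right-hand side has degree at most `k ≤ m - 2` in `f` and its derivatives. Clunie's argument
shows that both `Q` and `f Q` are then small; if `Q` did not vanish identically, `f = (f Q) / Q`
would be small compared with itself (`sameMero_zero_of_pow_succ_mul`). Hence `Q = 0`, so that
`P' = φ P` and `L' = φ L`, and `P = c L` for a constant `c`. Now `f ^ m * R` has degree at most
`k < m`, and the same argument forces `R = 0`. This in turn reads `f * R₁ = -b_m` with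
`R₁ = ∑_{j > m} b_j f ^ (j - m - 1)`, whence `R₁ = 0` and `b_m = 0`, contrary to assumption
(`not_sameMero_polyCofactor`). The case `c = -1` shows that `F` is not identically zero in the
first place.

The finiteness of the sets of poles is what makes the proximity functions sufficient: all counting
functions that occur are `O(log r)`, and `log r = o(T(r, f))` because `f` is not rational
(`isRationalFunction_of_frequently_le_log`).

The lemma on the logarithmic derivative (`exists_eventually_proximity_logDeriv_le`) comes from
splitting `f` on a disc into a product over its zeros and poles and a zero-free factor `g`. The
derivative of the Herglotz integral bounds `g' / g` by a mean of `|log ‖g‖|`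
(`norm_logDeriv_le_circleAverage`). The simple fractions contribute only the logarithm of their
number, since by Jensen's formula and Cartan's identity each `1 / (N (z - a))` has proximity
function at most `1 / N` (`circleAverage_posLog_inv_const_mul_sub_le`). Borel's growth lemma
(`eventually_nevFilter_lt_two_mul`) then compares the characteristic at neighbouring radii, outside
a set of finite measure.
-/

namespace NevanlinnaSmall

open Real Metric Topology ValueDistribution

/-! ### Radii outside sets of finite measure -/

/-- The filter of radii tending to infinity outside sets of finite Lebesgue measure: a property
holds eventually along it if it holds for all large `r` outside some set of finite measure. -/
noncomputable def nevFilter : Filter ℝ := atTop ⊓ (volume : Measure ℝ).cofinite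

instance nevFilter_neBot : nevFilter.NeBot := by
  rw [nevFilter, inf_neBot_iff]
  intro s hs t ht
  obtain ⟨a, ha⟩ := mem_atTop_sets.1 hs
  by_contra h
  have hsub : Ici a ⊆ tᶜ := fun x hx hxt => h ⟨x, ha x hx, hxt⟩
  have := (measure_mono hsub).trans_lt (Measure.mem_cofinite.1 ht)
  simp at this

lemma nevFilter_le_atTop : nevFilter ≤ atTop := inf_le_left

/-- **Borel's growth lemma.** On the dyadic level `2 ^ k ≤ T < 2 ^ (k + 1)`, two exceptional radii
cannot be more than `2 ^ (-k)` apart, so the exceptional set has measure at most `∑ 2 ^ (-k)`. -/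
lemma eventually_nevFilter_lt_two_mul {T : ℝ → ℝ} (hT : MonotoneOn T (Ici 1))
    (h1 : ∀ r, 1 ≤ r → 1 ≤ T r) :
    ∀ᶠ r in nevFilter, T (r + (T r)⁻¹) < 2 * T r := by
  set E : Set ℝ := {r | 1 ≤ r ∧ 2 * T r ≤ T (r + (T r)⁻¹)} with hE
  set F : ℕ → Set ℝ := fun k => {r | r ∈ E ∧ 2 ^ k ≤ T r ∧ T r < 2 ^ (k + 1)} with hF
  have hsub : E ⊆ ⋃ k, F k := by
    intro r hr
    obtain ⟨k, hk1, hk2⟩ := exists_nat_pow_near (h1 r hr.1) (one_lt_two (α := ℝ))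
    exact mem_iUnion.2 ⟨k, hr, hk1, hk2⟩
  have hstep : ∀ k, ∀ r ∈ F k, ∀ s ∈ F k, s ≤ r + (2 ^ k)⁻¹ := by
    intro k r hr s hs
    by_contra! hlt
    have hpos : (0 : ℝ) < 2 ^ k := by positivity
    have hTr : 0 < T r := hpos.trans_le hr.2.1
    have hinv : (T r)⁻¹ ≤ (2 ^ k)⁻¹ := inv_anti₀ hpos hr.2.1
    have hmono : T (r + (T r)⁻¹) ≤ T s :=
      hT (by simpa using hr.1.1.trans (le_add_of_nonneg_right (inv_pos.2 hTr).le))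
        hs.1.1 (by linarith)
    have := hr.1.2
    have h2 := hr.2.1
    have h3 := hs.2.2
    rw [pow_succ] at h3
    linarith
  have hvol : ∀ k, volume (F k) ≤ ENNReal.ofReal ((1 / 2) ^ k) := by
    intro k
    refine (Real.volume_le_diam (F k)).trans (Metric.ediam_le fun x hx y hy => ?_)
    rw [edist_dist]
    refine ENNReal.ofReal_le_ofReal ?_
    have h1 := hstep k x hx y hy
    have h2 := hstep k y hy x hx
    rw [Real.dist_eq, one_div, inv_pow, abs_le]
    constructor <;> linarith
  have hfin : volume E < ⊤ := by
    refine (measure_mono hsub).trans_lt ((measure_iUnion_le F).trans_lt ?_)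
    refine (ENNReal.tsum_le_tsum hvol).trans_lt ?_
    rw [← ENNReal.ofReal_tsum_of_nonneg (fun n => by positivity) summable_geometric_two]
    exact ENNReal.ofReal_lt_top
  have hcof : ∀ᶠ r in nevFilter, r ∉ E :=
    (inf_le_right : nevFilter ≤ _) (Measure.compl_mem_cofinite.2 hfin)
  filter_upwards [hcof, nevFilter_le_atTop (eventually_ge_atTop 1)] with r hr hr1
  by_contra! hcon
  exact hr ⟨hr1, hcon⟩

/-! ### Mean values over circles -/

lemma circleAverage_mono_codiscreteWithin {u v : ℂ → ℝ} {c : ℂ} {R : ℝ}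
    (hu : CircleIntegrable u c R) (hv : CircleIntegrable v c R) (hR : R ≠ 0)
    (h : u ≤ᶠ[codiscreteWithin (sphere c |R|)] v) :
    circleAverage u c R ≤ circleAverage v c R := by
  have hmin : u =ᶠ[codiscreteWithin (sphere c |R|)] fun z => min (u z) (v z) := by
    filter_upwards [h] with z hz
    exact (min_eq_left hz).symm
  rw [circleAverage_congr_codiscreteWithin hmin hR]
  exact circleAverage_mono (hu.congr_codiscreteWithin hmin) hv fun z _ => min_le_right _ _

lemma eventually_codiscreteWithin_ne (p : ℂ) (U : Set ℂ) : ∀ᶠ z in codiscreteWithin U, z ≠ p :=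
  compl_singleton_mem_codiscreteWithin p

/-- The derivative of the Herglotz integral controls the logarithmic derivative of a zero-free
function by the mean of `|log ‖g‖|` over the boundary circle. -/
lemma norm_logDeriv_le_circleAverage {g : ℂ → ℂ} {R : ℝ} {w : ℂ}
    (hg : AnalyticOnNhd ℂ g (closedBall 0 R)) (hne : ∀ z ∈ closedBall 0 R, g z ≠ 0)
    (hw : w ∈ ball 0 R) :
    ‖logDeriv g w‖ ≤ 2 * R / (R - ‖w‖) ^ 2 * circleAverage (fun z => |log ‖g z‖|) 0 R := by
  have hR : 0 < R := pos_of_mem_ball hw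
  have hwR : ‖w‖ < R := by simpa using hw
  set u : ℂ → ℝ := fun z => log ‖g z‖ with hu
  have hharm : InnerProductSpace.HarmonicOnNhd u (closedBall 0 R) :=
    fun z hz => (hg z hz).harmonicAt_log_norm (hne z hz)
  have hint : CircleIntegrable u 0 R := by
    refine MeromorphicOn.circleIntegrable_log_norm fun z hz => (hg z ?_).meromorphicAt
    rw [abs_of_pos hR] at hz
    exact sphere_subset_closedBall hz
  have hintC : CircleIntegrable (fun z => (u z : ℂ)) 0 R := by
    simp only [CircleIntegrable, intervalIntegrable_iff] at hint ⊢
    exact Complex.ofRealCLM.integrable_comp hint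
  set F : ℂ → ℂ := fun w => circleAverage (fun ζ ↦ herglotzRieszKernel 0 w ζ • (u ζ : ℂ)) 0 R
    with hF
  have hFd : ∀ w ∈ ball (0 : ℂ) R, HasDerivAt F
      (circleAverage (fun ζ ↦ (2 * ζ / (ζ - w) ^ 2) • (u ζ : ℂ)) 0 R) w :=
    fun w hw => hasDerivAt_circleAverage_herglotzRieszKernel_smul hintC hw
  have hFre : ∀ w ∈ ball (0 : ℂ) R, (F w).re = log ‖g w‖ := by
    intro w hw
    rw [hF, re_circleAverage_herglotzRieszKernel_smul hint hw]
    exact hharm.circleAverage_re_herglotzRieszKernel_smul hw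
  -- `exp F / g` has modulus one on the disc, hence is constant there
  have hgd : ∀ z ∈ ball (0 : ℂ) R, DifferentiableAt ℂ g z :=
    fun z hz => (hg z (ball_subset_closedBall hz)).differentiableAt
  have hgne : ∀ z ∈ ball (0 : ℂ) R, g z ≠ 0 := fun z hz => hne z (ball_subset_closedBall hz)
  set q : ℂ → ℂ := fun z => Complex.exp (F z) / g z with hq
  have hqn : ∀ z ∈ ball (0 : ℂ) R, ‖q z‖ = 1 := by
    intro z hz
    have hpos : 0 < ‖g z‖ := norm_pos_iff.2 (hgne z hz)
    rw [hq, norm_div, Complex.norm_exp, hFre z hz, exp_log hpos, div_self hpos.ne']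
  have hqd : DifferentiableOn ℂ q (ball 0 R) := fun z hz =>
    ((hFd z hz).differentiableAt.cexp.div (hgd z hz) (hgne z hz)).differentiableWithinAt
  have hqc : EqOn q (Function.const ℂ (q w)) (ball 0 R) :=
    Complex.eqOn_of_isPreconnected_of_isMaxOn_norm (convex_ball 0 R).isPreconnected isOpen_ball
      hqd hw (fun z hz => by simp [hqn z hz, hqn w hw])
  have hexp : (fun z => Complex.exp (F z)) =ᶠ[𝓝 w] fun z => q w * g z := by
    filter_upwards [isOpen_ball.mem_nhds hw] with z hz
    have h := hqc hz
    simp only [hq, Function.const] at h ⊢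
    rw [← h, div_mul_cancel₀ _ (hgne z hz)]
  have hder := hexp.deriv_eq
  rw [((hFd w hw).cexp).deriv, deriv_const_mul _ (hgd w hw), hexp.eq_of_nhds] at hder
  have hqw : q w ≠ 0 := norm_ne_zero_iff.1 (by rw [hqn w hw]; exact one_ne_zero)
  have hlog : logDeriv g w = circleAverage (fun ζ ↦ (2 * ζ / (ζ - w) ^ 2) • (u ζ : ℂ)) 0 R := by
    rw [logDeriv_apply, div_eq_iff (hgne w hw)]
    apply mul_left_cancel₀ hqw
    rw [← hder]
    ring
  rw [hlog, circleAverage_def, circleAverage_def, norm_smul, smul_eq_mul, mul_left_comm,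
    norm_inv, norm_of_nonneg two_pi_pos.le]
  refine mul_le_mul_of_nonneg_left ?_ (inv_nonneg.2 two_pi_pos.le)
  rw [← intervalIntegral.integral_const_mul]
  refine intervalIntegral.norm_integral_le_of_norm_le two_pi_pos.le
    (Eventually.of_forall fun θ _ => ?_) ((hint.abs).const_mul _)
  have hdist : R - ‖w‖ ≤ ‖circleMap 0 R θ - w‖ := by
    have := norm_sub_norm_le (circleMap 0 R θ) w
    rwa [norm_circleMap_zero, abs_of_pos hR] at this
  rw [norm_smul, norm_div, norm_mul, norm_pow, norm_circleMap_zero, abs_of_pos hR,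
    Complex.norm_real, Complex.norm_ofNat]
  have : 0 < R - ‖w‖ := by linarith
  simp only [norm_eq_abs]
  gcongr

lemma circleAverage_abs_log_norm_sub_le {a : ℂ} {R : ℝ} (hR : 1 ≤ R) (ha : a ∈ closedBall 0 R) :
    circleAverage (fun z => |log ‖z - a‖|) 0 R ≤ 2 * log 2 + log R := by
  have h0 : 0 < R := by linarith
  have haR : ‖a‖ ≤ R := by simpa using ha
  have hm : MeromorphicOn (fun z : ℂ => z - a) (sphere 0 |R|) := fun z _ => by fun_prop
  have hint := hm.circleIntegrable_log_norm
  have hpos := hm.circleIntegrable_posLog_norm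
  have heq : (fun z : ℂ => |log ‖z - a‖|) =
      fun z => 2 * log⁺ ‖z - a‖ - log ‖z - a‖ := by
    funext z
    have := half_mul_log_add_log_abs (x := ‖z - a‖)
    linarith
  have hpl : circleAverage (fun z => log⁺ ‖z - a‖) 0 R ≤ log 2 + log R := by
    refine circleAverage_mono_on_of_le_circle hpos fun z hz => ?_
    have hz : ‖z‖ = R := by simpa [abs_of_pos h0] using hz
    rw [← log_mul two_ne_zero h0.ne', ← posLog_eq_log (x := 2 * R)
      (by rw [abs_of_pos (by positivity)]; linarith)]
    exact posLog_le_posLog (norm_nonneg _) ((norm_sub_le _ _).trans (by linarith))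
  rw [heq, circleAverage_fun_sub (f₁ := fun z : ℂ => 2 * log⁺ ‖z - a‖)
    (hpos.const_mul 2) hint]
  have hs : circleAverage (fun z : ℂ => 2 * log⁺ ‖z - a‖) 0 R
      = 2 * circleAverage (fun z : ℂ => log⁺ ‖z - a‖) 0 R := circleAverage_fun_smul (a := (2:ℝ))
  have hj : circleAverage (fun z : ℂ => log ‖z - a‖) 0 R = log R :=
    circleAverage_log_norm_sub_const_of_mem_closedBall (by rwa [abs_of_pos h0])
  rw [hs, hj]
  linarith

lemma posLog_add_le_posLog_add {x y : ℝ} (hx : 0 ≤ x) (hy : 0 ≤ y) : log⁺ (x + y) ≤ log⁺ x + y := by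
  rw [posLog_eq_log_max_one (by positivity), posLog_eq_log_max_one hx]
  have h1 : (1 : ℝ) ≤ max 1 x := le_max_left _ _
  have h2 : max 1 (x + y) ≤ max 1 x * (1 + y) := by
    apply max_le
    · nlinarith
    · nlinarith [le_max_right 1 x]
  have h3 := log_le_log (by positivity) h2
  rw [log_mul (by positivity) (by positivity)] at h3
  have h4 := log_le_sub_one_of_pos (show 0 < 1 + y by positivity)
  linarith

lemma circleAverage_log_norm_const_mul_sub {N : ℝ} (hN : 0 < N) (a : ℂ) {r : ℝ} (hr : 0 < r) :
    circleAverage (fun z : ℂ => log ‖(N : ℂ) * (z - a)‖) 0 r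
      = log N + (log r + log⁺ (r⁻¹ * ‖a‖)) := by
  have h1 : circleAverage (fun z : ℂ => log ‖(N : ℂ) * (z - a)‖) 0 r
      = circleAverage (fun z : ℂ => log N + log ‖z - a‖) 0 r := by
    refine circleAverage_congr_codiscreteWithin ?_ hr.ne'
    filter_upwards [eventually_codiscreteWithin_ne a _] with z hz
    rw [norm_mul, log_mul (by simpa using hN.ne') (norm_ne_zero_iff.2 (sub_ne_zero.2 hz))]
    simp [abs_of_pos hN]
  rw [h1, circleAverage_fun_add (circleIntegrable_const _ _ _)
    (circleIntegrable_log_norm_sub_const r), circleAverage_const,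
    circleAverage_log_norm_sub_const_eq_log_radius_add_posLog hr.ne']
  simp

/-- By Jensen's formula and Cartan's identity, a simple pole of residue `1 / N` contributes at most
`1 / N` to the proximity function. -/
lemma circleAverage_posLog_inv_const_mul_sub_le {N : ℝ} (hN : 0 < N) (a : ℂ) {r : ℝ} (hr : 1 ≤ r) :
    circleAverage (fun z : ℂ => log⁺ ‖((N : ℂ) * (z - a))⁻¹‖) 0 r ≤ N⁻¹ := by
  have hr0 : 0 < r := by linarith
  set f : ℂ → ℂ := fun z => (N : ℂ) * (z - a) with hf
  have hfm : Meromorphic f := fun z => by fun_prop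
  have h1 : proximity f ⊤ r - proximity f⁻¹ ⊤ r = circleAverage (log ‖f ·‖) 0 r :=
    congrFun (proximity_sub_proximity_inv_eq_circleAverage hfm) r
  have hinv : proximity f⁻¹ ⊤ r =
      circleAverage (fun z : ℂ => log⁺ ‖((N : ℂ) * (z - a))⁻¹‖) 0 r := by
    simp [proximity_top, hf]
  have hj : circleAverage (log ‖f ·‖) 0 r = log N + (log r + log⁺ (r⁻¹ * ‖a‖)) :=
    circleAverage_log_norm_const_mul_sub hN a hr0
  have h2 : proximity f ⊤ r ≤ log N + (log r + log⁺ (r⁻¹ * ‖a‖)) + N⁻¹ := by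
    rw [← congrFun (circleAverage_circleAverage_eq_proximity_top hfm) r]
    refine circleAverage_mono_on_of_le_circle (circleIntegrable_circleAverage_log_norm_sub hfm)
      fun b hb => ?_
    have hb : ‖b‖ = 1 := by simpa using hb
    have hNC : (N : ℂ) ≠ 0 := by exact_mod_cast hN.ne'
    have heq : (fun z => log ‖f z - b‖) = fun z : ℂ => log ‖(N : ℂ) * (z - (a + b / N))‖ := by
      funext z
      congr 2
      simp only [hf]
      field_simp
      ring
    rw [heq, circleAverage_log_norm_const_mul_sub hN _ hr0]
    have hnorm : r⁻¹ * ‖a + b / N‖ ≤ r⁻¹ * ‖a‖ + N⁻¹ := by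
      have h3 : ‖b / (N : ℂ)‖ = N⁻¹ := by simp [hb, abs_of_pos hN]
      have h4 := norm_add_le a (b / N)
      rw [h3] at h4
      have h5 : r⁻¹ ≤ 1 := inv_le_one_of_one_le₀ hr
      calc r⁻¹ * ‖a + b / N‖ ≤ r⁻¹ * (‖a‖ + N⁻¹) := by gcongr
        _ = r⁻¹ * ‖a‖ + r⁻¹ * N⁻¹ := by ring
        _ ≤ r⁻¹ * ‖a‖ + 1 * N⁻¹ := by gcongr
        _ = _ := by ring
    have h6 := (posLog_le_posLog (by positivity) hnorm).trans
      (posLog_add_le_posLog_add (x := r⁻¹ * ‖a‖) (y := N⁻¹) (by positivity) (by positivity))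
    linarith
  rw [← hinv]
  linarith

/-- A sum of `n` simple fractions has mean `log⁺` of size `O(log n)`, rather than the `O(n)` that
estimating the terms one by one would give. -/
lemma exists_posLog_sum_le (S : Finset ℂ) (d : ℂ → ℤ) {r : ℝ} (hr : 1 ≤ r) :
    ∃ v : ℂ → ℝ, CircleIntegrable v 0 r ∧
      (∀ z, log⁺ (∑ u ∈ S, (|d u| : ℝ) * ‖z - u‖⁻¹) ≤ v z) ∧
      circleAverage v 0 r ≤ 2 * log⁺ (∑ u ∈ S, (|d u| : ℝ)) + 1 := by
  classical
  have hr0 : 0 < r := by linarith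
  set n : ℝ := ∑ u ∈ S, (|d u| : ℝ) with hn
  set S' := S.filter (fun u => d u ≠ 0) with hS'
  have hd1 : ∀ u ∈ S', (1 : ℝ) ≤ |(d u : ℝ)| := fun u hu => by
    have := Int.one_le_abs (Finset.mem_filter.1 hu).2
    exact_mod_cast this
  have hcard : (S'.card : ℝ) ≤ n := by
    calc (S'.card : ℝ) = ∑ u ∈ S', (1 : ℝ) := by simp
      _ ≤ ∑ u ∈ S', |(d u : ℝ)| := Finset.sum_le_sum hd1
      _ ≤ n := Finset.sum_le_sum_of_subset_of_nonneg (Finset.filter_subset _ _)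
          fun _ _ _ => abs_nonneg _
  have hsum : ∀ c : ℂ → ℝ, ∑ u ∈ S, (|d u| : ℝ) * c u = ∑ u ∈ S', (|d u| : ℝ) * c u := by
    intro c
    rw [hS', Finset.sum_filter]
    refine Finset.sum_congr rfl fun u _ => ?_
    by_cases h : d u = 0 <;> simp [h]
  have hnS' : n = ∑ u ∈ S', (|d u| : ℝ) := by simpa using hsum fun _ => 1
  rcases S'.eq_empty_or_nonempty with hemp | hne
  · refine ⟨fun _ => 0, circleIntegrable_const _ _ _, fun z => by simp [hsum, hemp], ?_⟩
    rw [circleAverage_const]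
    linarith [posLog_nonneg (x := n)]
  have hn1 : 1 ≤ n := by
    have : (1 : ℝ) ≤ S'.card := by exact_mod_cast hne.card_pos
    linarith
  have hn0 : 0 < n := by linarith
  have hmero : ∀ u, MeromorphicOn (fun z : ℂ => ((n : ℂ) * (z - u))⁻¹) (sphere 0 |r|) :=
    fun u z _ => by fun_prop
  have hint : ∀ u ∈ S', CircleIntegrable (fun z : ℂ => log⁺ ‖((n : ℂ) * (z - u))⁻¹‖) 0 r :=
    fun u _ => (hmero u).circleIntegrable_posLog_norm
  set v : ℂ → ℝ := fun z => 2 * log⁺ n + ∑ u ∈ S', log⁺ ‖((n : ℂ) * (z - u))⁻¹‖ with hv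
  have hvint : CircleIntegrable v 0 r :=
    (circleIntegrable_const _ _ _).add (CircleIntegrable.fun_sum S' hint)
  have hle : ∀ z, log⁺ (∑ u ∈ S, (|d u| : ℝ) * ‖z - u‖⁻¹) ≤ v z := by
    intro z
    obtain ⟨u₀, hu₀, hmax⟩ := S'.exists_max_image (fun u => ‖z - u‖⁻¹) hne
    have h1 : ∑ u ∈ S, (|d u| : ℝ) * ‖z - u‖⁻¹ ≤ n ^ 2 * ‖((n : ℂ) * (z - u₀))⁻¹‖ := by
      rw [hsum]
      calc ∑ u ∈ S', (|d u| : ℝ) * ‖z - u‖⁻¹ ≤ ∑ u ∈ S', (|d u| : ℝ) * ‖z - u₀‖⁻¹ :=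
            Finset.sum_le_sum fun u hu => mul_le_mul_of_nonneg_left (hmax u hu) (abs_nonneg _)
        _ = n * ‖z - u₀‖⁻¹ := by rw [← Finset.sum_mul, ← hnS']
        _ = n ^ 2 * ‖((n : ℂ) * (z - u₀))⁻¹‖ := by
            rw [norm_inv, norm_mul, Complex.norm_real, norm_of_nonneg hn0.le, mul_inv]
            field_simp
    refine (posLog_le_posLog (Finset.sum_nonneg fun u _ => by positivity) h1).trans
      (posLog_mul.trans ?_)
    rw [posLog_pow, hv]
    push_cast
    gcongr
    exact Finset.single_le_sum (f := fun u => log⁺ ‖((n : ℂ) * (z - u))⁻¹‖)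
      (fun _ _ => posLog_nonneg) hu₀
  have hv_avg : circleAverage v 0 r ≤ 2 * log⁺ n + 1 := by
    rw [hv, circleAverage_fun_add (circleIntegrable_const _ _ _)
      (CircleIntegrable.fun_sum S' hint), circleAverage_const, circleAverage_fun_sum hint]
    gcongr
    calc ∑ u ∈ S', circleAverage (fun z : ℂ => log⁺ ‖((n : ℂ) * (z - u))⁻¹‖) 0 r
        ≤ ∑ u ∈ S', n⁻¹ := Finset.sum_le_sum fun u _ =>
          circleAverage_posLog_inv_const_mul_sub_le hn0 u hr
      _ = S'.card * n⁻¹ := by simp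
      _ ≤ n * n⁻¹ := by gcongr
      _ = 1 := mul_inv_cancel₀ hn0.ne'
  exact ⟨v, hvint, hle, hv_avg⟩

/-- If `f = ∏ (z - u) ^ d u * g` near the circle, the mean of `|log ‖g‖|` is controlled by the
proximity functions of `f` and `1 / f` and the number of extracted zeros and poles. -/
lemma circleAverage_abs_log_norm_le {f g : ℂ → ℂ} {S : Finset ℂ} {d : ℂ → ℤ} {R : ℝ} (hR : 1 ≤ R)
    (hf : Meromorphic f) (hg : AnalyticOnNhd ℂ g (closedBall 0 R))
    (hne : ∀ z ∈ closedBall 0 R, g z ≠ 0) (hS : ∀ u ∈ S, u ∈ closedBall 0 R)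
    (hfg : f =ᶠ[codiscreteWithin (closedBall 0 R)] fun z => (∏ u ∈ S, (z - u) ^ d u) * g z) :
    circleAverage (fun z => |log ‖g z‖|) 0 R ≤
      proximity f ⊤ R + proximity f⁻¹ ⊤ R
        + (∑ u ∈ S, (|d u| : ℝ)) * (2 * log 2 + log R) := by
  have hR0 : 0 < R := by linarith
  have hsph : sphere (0 : ℂ) |R| ⊆ closedBall 0 R := by
    rw [abs_of_pos hR0]; exact sphere_subset_closedBall
  have hint1 : CircleIntegrable (fun z => log⁺ ‖f z‖) 0 R :=
    (hf.meromorphicOn).circleIntegrable_posLog_norm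
  have hint2 : CircleIntegrable (fun z => log⁺ ‖f⁻¹ z‖) 0 R :=
    (hf.inv.meromorphicOn).circleIntegrable_posLog_norm
  have hint3 : ∀ u ∈ S, CircleIntegrable (fun z => (|d u| : ℝ) * |log ‖z - u‖|) 0 R :=
    fun u _ => ((circleIntegrable_log_norm_sub_const R).abs).const_mul _
  have hintg : CircleIntegrable (fun z => |log ‖g z‖|) 0 R :=
    (MeromorphicOn.circleIntegrable_log_norm
      fun z hz => (hg z (hsph hz)).meromorphicAt).abs
  have hle : (fun z => |log ‖g z‖|) ≤ᶠ[codiscreteWithin (sphere 0 |R|)]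
      fun z => (log⁺ ‖f z‖ + log⁺ ‖f⁻¹ z‖) + ∑ u ∈ S, (|d u| : ℝ) * |log ‖z - u‖| := by
    have hS' : ∀ᶠ z in codiscreteWithin (sphere (0 : ℂ) |R|), ∀ u ∈ S, z ≠ u :=
      (Finset.eventually_all S).2 fun u _ => eventually_codiscreteWithin_ne u _
    filter_upwards [hfg.filter_mono (codiscreteWithin_mono hsph), hS',
      self_mem_codiscreteWithin _] with z hz hzS hzs
    have hgz : ‖g z‖ ≠ 0 := norm_ne_zero_iff.2 (hne z (hsph hzs))
    have hprod : ∀ u ∈ S, ‖(z - u) ^ d u‖ ≠ 0 := fun u hu =>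
      norm_ne_zero_iff.2 (zpow_ne_zero _ (sub_ne_zero.2 (hzS u hu)))
    have h1 : log ‖f z‖ = ∑ u ∈ S, (d u : ℝ) * log ‖z - u‖ + log ‖g z‖ := by
      rw [hz, norm_mul, norm_prod, log_mul (Finset.prod_ne_zero_iff.2 hprod) hgz, log_prod hprod]
      simp [log_zpow]
    have h2 : |log ‖f z‖| = log⁺ ‖f z‖ + log⁺ ‖f⁻¹ z‖ := by
      have h3 := posLog_sub_posLog_inv (x := ‖f z‖)
      have h4 := half_mul_log_add_log_abs (x := ‖f z‖)
      rw [Pi.inv_apply, norm_inv]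
      linarith
    have h5 : |∑ u ∈ S, (d u : ℝ) * log ‖z - u‖| ≤ ∑ u ∈ S, (|d u| : ℝ) * |log ‖z - u‖| :=
      (Finset.abs_sum_le_sum_abs _ _).trans (by simp [abs_mul])
    rw [← h2, show log ‖g z‖ = log ‖f z‖ - ∑ u ∈ S, (d u : ℝ) * log ‖z - u‖ by rw [h1]; ring]
    exact (abs_sub _ _).trans (by gcongr)
  have hint12 := hint1.add hint2
  have hint3' := CircleIntegrable.fun_sum S hint3
  refine (circleAverage_mono_codiscreteWithin hintg (hint12.add hint3') hR0.ne' hle).trans ?_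
  rw [circleAverage_add hint12 hint3', circleAverage_add hint1 hint2, circleAverage_fun_sum hint3,
    proximity_top, proximity_top, Finset.sum_mul]
  gcongr with u hu
  rw [show circleAverage (fun z => (|d u| : ℝ) * |log ‖z - u‖|) 0 R
    = (|d u| : ℝ) * circleAverage (fun z => |log ‖z - u‖|) 0 R from
      circleAverage_fun_smul (a := (|d u| : ℝ))]
  gcongr
  exact circleAverage_abs_log_norm_sub_le hR (hS u hu)

/-! ### Zeros, poles and the logarithmic derivative -/

lemma proximity_le_characteristic (f : ℂ → ℂ) {r : ℝ} (hr : 1 ≤ r) :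
    proximity f ⊤ r ≤ characteristic f ⊤ r :=
  le_add_of_nonneg_right (logCounting_nonneg hr)

lemma exists_characteristic_inv_le {f : ℂ → ℂ} (hf : Meromorphic f) :
    ∃ C, 0 ≤ C ∧ ∀ r, characteristic f⁻¹ ⊤ r ≤ characteristic f ⊤ r + C := by
  refine ⟨max |log ‖f 0‖| |log ‖meromorphicTrailingCoeffAt f 0‖|,
    (abs_nonneg _).trans (le_max_left _ _), fun r => ?_⟩
  have := (abs_le.1 (characteristic_sub_characteristic_inv_le hf (R := r))).1
  linarith

/-- The number of zeros and poles in the disc of radius `ρ`, with multiplicity, is bounded through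
the characteristic at a larger radius `r`: each of them contributes at least `log (r / ρ)` to one of
the counting functions. -/
lemma sum_abs_divisor_mul_log_le {f : ℂ → ℂ} {S : Finset ℂ} {ρ r : ℝ}
    (hρ : 1 ≤ ρ) (hr : ρ ≤ r) (hS : ∀ u ∈ S, u ∈ closedBall 0 ρ) :
    (∑ u ∈ S, (|MeromorphicOn.divisor f univ u| : ℝ)) * (log r - log ρ) ≤
      characteristic f ⊤ r + characteristic f⁻¹ ⊤ r := by
  classical
  set D := MeromorphicOn.divisor f univ with hD
  set E : Function.locallyFinsuppWithin (univ : Set ℂ) ℤ := D⁺ + D⁻ with hE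
  have hEu : ∀ u, E u = |D u| := fun u => by
    rw [hE, Function.locallyFinsuppWithin.coe_add, Pi.add_apply]
    simp [posPart_add_negPart]
  have hle : (∑ u ∈ S, Function.locallyFinsuppWithin.single u (E u)) ≤ E := by
    intro z
    rw [Function.locallyFinsuppWithin.coe_sum, Finset.sum_apply]
    by_cases hz : z ∈ S
    · rw [Finset.sum_eq_single z]
      · simp
      · intro b _ hb
        simp [Function.locallyFinsuppWithin.single_apply, hb.symm]
      · exact fun h => absurd hz h
    · rw [Finset.sum_eq_zero]
      · rw [hEu]; exact abs_nonneg _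
      · intro b hb
        have : z ≠ b := fun h => hz (h ▸ hb)
        simp [Function.locallyFinsuppWithin.single_apply, this]
  have hr1 : 1 ≤ r := hρ.trans hr
  have h1 := Function.locallyFinsuppWithin.logCounting_le hle hr1
  have h2 : Function.locallyFinsuppWithin.logCounting E r
      ≤ characteristic f ⊤ r + characteristic f⁻¹ ⊤ r := by
    rw [hE, map_add, Pi.add_apply, hD, ← logCounting_zero, ← logCounting_top, ← logCounting_inv,
      add_comm]
    exact add_le_add (le_add_of_nonneg_left (proximity_nonneg r))
      (le_add_of_nonneg_left (proximity_nonneg r))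
  refine le_trans ?_ (h1.trans h2)
  rw [map_sum, Finset.sum_apply, Finset.sum_mul]
  refine Finset.sum_le_sum fun u hu => ?_
  have huρ : ‖u‖ ≤ ρ := by simpa using hS u hu
  rw [Function.locallyFinsuppWithin.logCounting_single_eq_log_sub_const (huρ.trans hr), hEu]
  push_cast
  refine mul_le_mul_of_nonneg_left (sub_le_sub_left ?_ _) (abs_nonneg _)
  rcases eq_or_ne u 0 with rfl | h0
  · simpa using log_nonneg hρ
  · exact log_le_log (norm_pos_iff.2 h0) huρ

/-- Zeros and poles of `f` in a closed disc, split off as a finite product. -/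
lemma exists_prod_zpow_mul_eventuallyEq {f : ℂ → ℂ} (hf : Meromorphic f)
    (hord : ∀ z, meromorphicOrderAt f z ≠ ⊤) {U : Set ℂ}
    (hU : (MeromorphicOn.divisor f U).support.Finite) :
    ∃ (S : Finset ℂ) (g : ℂ → ℂ), AnalyticOnNhd ℂ g U ∧ (∀ z ∈ U, g z ≠ 0) ∧ (∀ u ∈ S, u ∈ U) ∧
      f =ᶠ[codiscreteWithin U]
        fun z => (∏ u ∈ S, (z - u) ^ MeromorphicOn.divisor f univ u) * g z := by
  obtain ⟨g, hg, hne, hfg⟩ :=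
    MeromorphicOn.extract_zeros_poles (hf.meromorphicOn (s := U)) (fun u => hord u) hU
  have hSU : ∀ u ∈ hU.toFinset, u ∈ U := fun u hu =>
    (MeromorphicOn.divisor f U).supportWithinDomain ((Set.Finite.mem_toFinset _).1 hu)
  refine ⟨hU.toFinset, g, hg, fun z hz => hne ⟨z, hz⟩, hSU, ?_⟩
  filter_upwards [hfg] with z hz
  rw [hz, Pi.smul_apply', smul_eq_mul,
    finprod_eq_prod_of_mulSupport_subset (s := hU.toFinset)]
  · rw [Finset.prod_apply]
    congr 1
    refine Finset.prod_congr rfl fun u hu => ?_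
    rw [Pi.pow_apply, MeromorphicOn.divisor_apply hf.meromorphicOn (hSU u hu),
      MeromorphicOn.divisor_apply hf.meromorphicOn (mem_univ u)]
  · rw [Function.FactorizedRational.mulSupport]
    simp

lemma logDeriv_prod_zpow_mul {S : Finset ℂ} {d : ℂ → ℤ} {g : ℂ → ℂ} {z : ℂ}
    (hz : ∀ u ∈ S, z ≠ u) (hg : DifferentiableAt ℂ g z) (hne : g z ≠ 0) :
    logDeriv (fun z => (∏ u ∈ S, (z - u) ^ d u) * g z) z
      = ∑ u ∈ S, d u * (z - u)⁻¹ + logDeriv g z := by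
  have hz' : ∀ u ∈ S, z - u ≠ 0 := fun u hu => sub_ne_zero.2 (hz u hu)
  have hd : ∀ u ∈ S, DifferentiableAt ℂ (fun z : ℂ => (z - u) ^ d u) z := fun u hu =>
    (differentiableAt_id.sub_const u).zpow (Or.inl (hz' u hu))
  rw [logDeriv_mul z (Finset.prod_ne_zero_iff.2 fun u hu => zpow_ne_zero _ (hz' u hu)) hne
    (DifferentiableAt.fun_finsetProd hd) hg, logDeriv_prod (f := fun u z => (z - u) ^ d u)
      (fun u hu => zpow_ne_zero _ (hz' u hu)) hd]
  congr 1
  refine Finset.sum_congr rfl fun u hu => ?_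
  rw [logDeriv_fun_zpow (f := fun z : ℂ => z - u) (by fun_prop), logDeriv_apply]
  simp

lemma logDeriv_eventuallyEq_of_eq_prod {f g : ℂ → ℂ} (hf : Meromorphic f) {U : Set ℂ}
    {S : Finset ℂ} {d : ℂ → ℤ} (hg : AnalyticOnNhd ℂ g U) (hne : ∀ z ∈ U, g z ≠ 0)
    (hfg : f =ᶠ[codiscreteWithin U] fun z => (∏ u ∈ S, (z - u) ^ d u) * g z) :
    logDeriv f =ᶠ[codiscreteWithin U] fun z => ∑ u ∈ S, d u * (z - u)⁻¹ + logDeriv g z := by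
  have hm : MeromorphicOn (fun z => (∏ u ∈ S, (z - u) ^ d u) * g z) U := fun z hz =>
    MeromorphicAt.fun_mul (by fun_prop) (hg z hz).meromorphicAt
  have hS : ∀ᶠ z in codiscreteWithin U, ∀ u ∈ S, z ≠ u :=
    (Finset.eventually_all S).2 fun u _ => eventually_codiscreteWithin_ne u _
  filter_upwards [hfg, hf.meromorphicOn.deriv_eventuallyEq_codiscreteWithin hm hfg, hS,
    self_mem_codiscreteWithin U] with z h1 h2 h3 h4
  rw [← logDeriv_prod_zpow_mul h3 (hg z h4).differentiableAt (hne z h4), logDeriv_apply,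
    logDeriv_apply, h1, h2]

lemma proximity_logDeriv_le_of_eq_prod {f g : ℂ → ℂ} (hf : Meromorphic f) {S : Finset ℂ}
    {d : ℂ → ℤ} {r R : ℝ} (hr : 1 ≤ r) (hrR : r < R)
    (hg : AnalyticOnNhd ℂ g (closedBall 0 R)) (hne : ∀ z ∈ closedBall 0 R, g z ≠ 0)
    (hfg : f =ᶠ[codiscreteWithin (closedBall 0 R)] fun z => (∏ u ∈ S, (z - u) ^ d u) * g z) :
    proximity (logDeriv f) ⊤ r ≤ log 2 + (2 * log⁺ (∑ u ∈ S, (|d u| : ℝ)) + 1)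
      + log⁺ (2 * R / (R - r) ^ 2 * circleAverage (fun z => |log ‖g z‖|) 0 R) := by
  have hr0 : 0 < r := by linarith
  set K := 2 * R / (R - r) ^ 2 * circleAverage (fun z => |log ‖g z‖|) 0 R with hK
  obtain ⟨X, hXint, hXle, hXavg⟩ := exists_posLog_sum_le S d hr
  have hsph : sphere (0 : ℂ) |r| ⊆ closedBall 0 R := by
    rw [abs_of_pos hr0]
    exact sphere_subset_closedBall.trans (closedBall_subset_closedBall hrR.le)
  have hm : Meromorphic (logDeriv f) := hf.deriv.div hf
  have hle : (fun z => log⁺ ‖logDeriv f z‖) ≤ᶠ[codiscreteWithin (sphere 0 |r|)]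
      fun z => (log 2 + log⁺ K) + X z := by
    filter_upwards [(logDeriv_eventuallyEq_of_eq_prod hf hg hne hfg).filter_mono
      (codiscreteWithin_mono hsph), self_mem_codiscreteWithin _] with z hz hzs
    have hzr : ‖z‖ = r := by simpa [abs_of_pos hr0] using hzs
    rw [hz]
    have h1 := posLog_norm_add_le (∑ u ∈ S, (d u : ℂ) * (z - u)⁻¹) (logDeriv g z)
    have h2 : log⁺ ‖logDeriv g z‖ ≤ log⁺ K := by
      refine posLog_le_posLog (norm_nonneg _) ?_
      rw [hK, ← hzr]
      exact norm_logDeriv_le_circleAverage hg hne (by simpa [hzr] using hrR)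
    have h3 : log⁺ ‖∑ u ∈ S, (d u : ℂ) * (z - u)⁻¹‖ ≤ X z := by
      refine (posLog_le_posLog (norm_nonneg _)
        ((norm_sum_le _ _).trans (le_of_eq ?_))).trans (hXle z)
      refine Finset.sum_congr rfl fun u _ => ?_
      rw [norm_mul, norm_inv, Complex.norm_intCast]
    linarith
  have hint : CircleIntegrable (fun z => log⁺ ‖logDeriv f z‖) 0 r :=
    hm.meromorphicOn.circleIntegrable_posLog_norm
  rw [proximity_top]
  have hc : CircleIntegrable (fun _ : ℂ => log 2 + log⁺ K) 0 r := circleIntegrable_const _ _ _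
  refine (circleAverage_mono_codiscreteWithin hint (hc.add hXint) hr0.ne' hle).trans ?_
  rw [circleAverage_add hc hXint, circleAverage_const]
  linarith

/-! ### The lemma on the logarithmic derivative -/

/-- The numerical content of the logarithmic derivative lemma: with `t = 1 + T(r)`, the choices
`R = r + 1 / (2t)` and `R' = r + 1 / t` lose only powers of `r` and `t` under the logarithm. -/
lemma proximity_logDeriv_le {f : ℂ → ℂ} (hf : Meromorphic f)
    (hord : ∀ z, meromorphicOrderAt f z ≠ ⊤) {C r : ℝ} (hC : 0 ≤ C)
    (hCf : ∀ r, characteristic f⁻¹ ⊤ r ≤ characteristic f ⊤ r + C) (hr : 1 ≤ r)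
    (hgrow : 1 + characteristic f ⊤ (r + (1 + characteristic f ⊤ r)⁻¹)
      ≤ 2 * (1 + characteristic f ⊤ r)) :
    proximity (logDeriv f) ⊤ r ≤ log 2 + 1 + 2 * log (4 * (4 + C)) + log (272 * (4 + C))
      + 5 * log r + 8 * log (1 + characteristic f ⊤ r) := by
  have hT0 : 0 ≤ characteristic f ⊤ r := characteristic_nonneg hr
  set t := 1 + characteristic f ⊤ r with ht
  have ht1 : 1 ≤ t := by linarith
  have ht0 : 0 < t := by linarith
  set A := 4 + C with hA
  have hA0 : 4 ≤ A := by linarith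
  have htinv : t⁻¹ ≤ 1 := inv_le_one_of_one_le₀ ht1
  have htinv0 : 0 < t⁻¹ := inv_pos.2 ht0
  set R := r + t⁻¹ / 2 with hR
  set R' := r + t⁻¹ with hR'
  have hrR : r < R := by linarith
  have hRR' : R < R' := by linarith
  have hR1 : 1 ≤ R := by linarith
  have hR'2 : R' ≤ 2 * r := by linarith
  have hTR' : characteristic f ⊤ R' ≤ 2 * t := by linarith
  have hTR : characteristic f ⊤ R ≤ 2 * t :=
    (characteristic_monotoneOn hf (show 0 < R by linarith) (show 0 < R' by linarith)
      hRR'.le).trans hTR'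
  obtain ⟨S, g, hg, hne, hS, hfg⟩ := exists_prod_zpow_mul_eventuallyEq hf hord
    ((MeromorphicOn.divisor f (closedBall 0 R)).finiteSupport (isCompact_closedBall 0 R))
  have hprox := proximity_logDeriv_le_of_eq_prod hf hr hrR hg hne hfg
  have hB := circleAverage_abs_log_norm_le hR1 hf hg hne hS hfg
  have hcount := sum_abs_divisor_mul_log_le (f := f) hR1 hRR'.le hS
  set n : ℝ := ∑ u ∈ S, (|MeromorphicOn.divisor f univ u| : ℝ) with hn
  set B := circleAverage (fun z => |log ‖g z‖|) 0 R with hBdef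
  have hn0 : 0 ≤ n := Finset.sum_nonneg fun _ _ => abs_nonneg _
  have hB0 : 0 ≤ B := circleAverage_nonneg_of_nonneg fun _ _ => abs_nonneg _
  -- the number of zeros and poles
  have hlog : t⁻¹ / (4 * r) ≤ log R' - log R := by
    have h1 : 0 < R / R' := by positivity
    have h2 := log_le_sub_one_of_pos h1
    rw [log_div (by positivity) (by positivity)] at h2
    have h3 : t⁻¹ / (4 * r) ≤ 1 - R / R' := by
      rw [one_sub_div (by positivity), div_le_div_iff₀ (by positivity) (by positivity)]
      have : R' - R = t⁻¹ / 2 := by rw [hR, hR']; ring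
      rw [this]
      nlinarith
    linarith
  have hnle : n ≤ 4 * A * r * t ^ 2 := by
    have h1 : n * (t⁻¹ / (4 * r)) ≤ A * t := by
      have h2 := mul_le_mul_of_nonneg_left hlog hn0
      have h3 := hCf R'
      have h4 : C ≤ C * t := le_mul_of_one_le_right hC ht1
      have h5 : A * t = 4 * t + C * t := by rw [hA]; ring
      linarith
    have h2 : n * (t⁻¹ / (4 * r)) * (4 * r * t) = n := by field_simp
    calc n = n * (t⁻¹ / (4 * r)) * (4 * r * t) := h2.symm
      _ ≤ A * t * (4 * r * t) := by gcongr
      _ = 4 * A * r * t ^ 2 := by ring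
  -- the mean of `|log ‖g‖|`
  have hBle : B ≤ 17 * A * r ^ 2 * t ^ 2 := by
    have h1 : proximity f ⊤ R + proximity f⁻¹ ⊤ R ≤ A * t := by
      have h2 := proximity_le_characteristic f hR1
      have h3 := proximity_le_characteristic f⁻¹ hR1
      have h4 := hCf R
      have h5 : C ≤ C * t := le_mul_of_one_le_right hC ht1
      have h6 : A * t = 4 * t + C * t := by rw [hA]; ring
      linarith
    have h2 : 2 * log 2 + log R ≤ 4 * r := by
      have h3 := log_le_sub_one_of_pos (show (0 : ℝ) < 2 by norm_num)
      have h4 := log_le_sub_one_of_pos (show 0 < R by positivity)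
      linarith
    have h3 : n * (2 * log 2 + log R) ≤ 4 * A * r * t ^ 2 * (4 * r) :=
      mul_le_mul hnle h2 (by have := log_nonneg hR1; positivity) (by positivity)
    have h4 : A * t ≤ A * r ^ 2 * t ^ 2 := by
      have h5 : 1 ≤ r ^ 2 := one_le_pow₀ hr
      have h6 : t ≤ r ^ 2 * t ^ 2 := by nlinarith
      nlinarith
    calc B ≤ _ := hB
      _ ≤ A * r ^ 2 * t ^ 2 + 4 * A * r * t ^ 2 * (4 * r) := by linarith
      _ = 17 * A * r ^ 2 * t ^ 2 := by ring
  have hK : 2 * R / (R - r) ^ 2 * B ≤ 272 * A * r ^ 3 * t ^ 4 := by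
    have h1 : 2 * R / (R - r) ^ 2 = 8 * R * t ^ 2 := by
      rw [show R - r = t⁻¹ / 2 by rw [hR]; ring]
      field_simp
      ring
    rw [h1]
    calc 8 * R * t ^ 2 * B ≤ 8 * (2 * r) * t ^ 2 * (17 * A * r ^ 2 * t ^ 2) := by
          gcongr
          linarith
      _ = 272 * A * r ^ 3 * t ^ 4 := by ring
  have hr3 : 1 ≤ r ^ 3 := one_le_pow₀ hr
  have ht4 : 1 ≤ t ^ 4 := one_le_pow₀ ht1
  have ht2 : 1 ≤ t ^ 2 := one_le_pow₀ ht1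
  have hlogn : log⁺ n ≤ log (4 * A) + log r + 2 * log t := by
    refine (posLog_le_posLog hn0 hnle).trans (le_of_eq ?_)
    have : 1 ≤ 4 * A * r * t ^ 2 :=
      one_le_mul_of_one_le_of_one_le (one_le_mul_of_one_le_of_one_le (by linarith) hr) ht2
    rw [posLog_eq_log (by rwa [abs_of_pos (by positivity)]),
      log_mul (by positivity) (by positivity), log_mul (by positivity) (by positivity), log_pow]
    norm_num
  have hlogK : log⁺ (2 * R / (R - r) ^ 2 * B) ≤ log (272 * A) + 3 * log r + 4 * log t := by
    refine (posLog_le_posLog (by positivity) hK).trans (le_of_eq ?_)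
    have : 1 ≤ 272 * A * r ^ 3 * t ^ 4 :=
      one_le_mul_of_one_le_of_one_le (one_le_mul_of_one_le_of_one_le (by linarith) hr3) ht4
    rw [posLog_eq_log (by rwa [abs_of_pos (by positivity)]),
      log_mul (by positivity) (by positivity), log_mul (by positivity) (by positivity), log_pow, log_pow]
    norm_num
  linarith

/-- **Lemma on the logarithmic derivative.** -/
theorem exists_eventually_proximity_logDeriv_le {f : ℂ → ℂ} (hf : Meromorphic f)
    (hord : ∀ z, meromorphicOrderAt f z ≠ ⊤) :
    ∃ C, ∀ᶠ r in nevFilter, proximity (logDeriv f) ⊤ r ≤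
      C + 5 * log r + 8 * log (1 + characteristic f ⊤ r) := by
  obtain ⟨C, hC, hCf⟩ := exists_characteristic_inv_le hf
  have hmono : MonotoneOn (fun r => 1 + characteristic f ⊤ r) (Ici 1) := fun x hx y hy hxy => by
    have hx : (1 : ℝ) ≤ x := hx
    have hy : (1 : ℝ) ≤ y := hy
    have := characteristic_monotoneOn hf (show 0 < x by linarith) (show 0 < y by linarith) hxy
    simpa using this
  have hB := eventually_nevFilter_lt_two_mul hmono
    fun r hr => by linarith [characteristic_nonneg (f := f) (a := ⊤) hr]
  refine ⟨log 2 + 1 + 2 * log (4 * (4 + C)) + log (272 * (4 + C)), ?_⟩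
  filter_upwards [hB, nevFilter_le_atTop (eventually_ge_atTop 1)] with r h1 h2
  exact proximity_logDeriv_le hf hord hC hCf h2 h1.le

/-! ### A characterization of rational functions -/

/-- A meromorphic function whose characteristic is `O(log r)` along some sequence of radii is
rational: it has finitely many zeros and poles, and the zero-free remaining factor has vanishing
logarithmic derivative. -/
theorem isRationalFunction_of_frequently_le_log {f : ℂ → ℂ} (hf : Meromorphic f)
    (hord : ∀ z, meromorphicOrderAt f z ≠ ⊤) {c : ℝ}
    (hc : ∃ᶠ r in atTop, characteristic f ⊤ r ≤ c * log r) : IsRationalFunction f := by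
  obtain ⟨C, hC, hCf⟩ := exists_characteristic_inv_le hf
  have hlogtop : Tendsto log atTop atTop := tendsto_log_atTop
  set D := MeromorphicOn.divisor f univ with hD
  -- any finite set of zeros and poles has at most `2 c + 1` elements
  have hcard : ∀ S : Finset ℂ, (∀ u ∈ S, u ∈ D.support) → (S.card : ℝ) ≤ 2 * c + 1 := by
    intro S hS
    obtain ⟨ρ, hρ⟩ := (S : Set ℂ).toFinite.isBounded.subset_closedBall 0
    have hSρ : ∀ u ∈ S, u ∈ closedBall 0 (max 1 ρ) := fun u hu =>
      closedBall_subset_closedBall (le_max_right _ _) (hρ hu)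
    have h1 : (S.card : ℝ) ≤ ∑ u ∈ S, (|D u| : ℝ) := by
      rw [Finset.cast_card]
      refine Finset.sum_le_sum fun u hu => ?_
      exact_mod_cast Int.one_le_abs (hS u hu)
    by_contra! hlt
    set n : ℝ := ∑ u ∈ S, (|D u| : ℝ) with hn
    obtain ⟨r, hr, hrρ, hrlog⟩ := (hc.and_eventually ((eventually_ge_atTop (max 1 ρ)).and
      (hlogtop.eventually_gt_atTop (C + n * log (max 1 ρ))))).exists
    have h2 := sum_abs_divisor_mul_log_le (f := f) (le_max_left _ _) hrρ hSρ
    have h3 := hCf r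
    rw [← hD, ← hn] at h2
    have hlogr : 0 ≤ log r := log_nonneg ((le_max_left _ _).trans hrρ)
    nlinarith
  have hfin : D.support.Finite := by
    by_contra hinf
    obtain ⟨S, hSsub, hScard⟩ := (show D.support.Infinite from hinf).exists_subset_card_eq
      (⌈2 * c + 1⌉₊ + 1)
    have h1 := hcard S fun u hu => hSsub hu
    rw [hScard] at h1
    push_cast at h1
    linarith [Nat.le_ceil (2 * c + 1)]
  obtain ⟨S, g, hg, hne, -, hfg⟩ := exists_prod_zpow_mul_eventuallyEq hf hord hfin
  rw [← hD] at hfg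
  obtain ⟨ρ, hρ⟩ := (S : Set ℂ).toFinite.isBounded.subset_closedBall 0
  set n : ℝ := ∑ u ∈ S, (|D u| : ℝ) with hn
  have hn0 : 0 ≤ n := Finset.sum_nonneg fun _ _ => abs_nonneg _
  have hderiv : ∀ w, logDeriv g w = 0 := by
    intro w
    set M : ℝ → ℝ := fun r => 2 * r / (r - ‖w‖) ^ 2 *
      (2 * (c * log r) + C + n * (2 * log 2 + log r)) with hM
    have hbound : ∃ᶠ r in atTop, ‖logDeriv g w‖ ≤ M r := by
      refine (hc.and_eventually ((eventually_ge_atTop (max 1 ρ)).and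
        (eventually_gt_atTop ‖w‖))).mono ?_
      rintro r ⟨hr, hrρ, hrw⟩
      have hr1 : 1 ≤ r := (le_max_left _ _).trans hrρ
      have hSr : ∀ u ∈ S, u ∈ closedBall 0 r := fun u hu =>
        closedBall_subset_closedBall ((le_max_right _ _).trans hrρ) (hρ hu)
      have hgr : AnalyticOnNhd ℂ g (closedBall 0 r) := hg.mono (subset_univ _)
      have hner : ∀ z ∈ closedBall (0 : ℂ) r, g z ≠ 0 := fun z _ => hne z (mem_univ z)
      have h1 := norm_logDeriv_le_circleAverage hgr hner (w := w) (by simpa using hrw)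
      have h2 := circleAverage_abs_log_norm_le hr1 hf hgr hner hSr
        (hfg.filter_mono (codiscreteWithin_mono (subset_univ _)))
      have h3 := proximity_le_characteristic f hr1
      have h4 := proximity_le_characteristic f⁻¹ hr1
      have h5 := hCf r
      refine h1.trans (mul_le_mul_of_nonneg_left ?_ (by positivity))
      linarith
    have hlim : Tendsto M atTop (𝓝 0) := by
      have hlr : Tendsto (fun r : ℝ => log r / r) atTop (𝓝 0) :=
        isLittleO_log_id_atTop.tendsto_div_nhds_zero
      have hir : Tendsto (fun r : ℝ => r⁻¹) atTop (𝓝 0) := tendsto_inv_atTop_zero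
      have h1 : Tendsto (fun r : ℝ => 2 / (1 - ‖w‖ * r⁻¹) ^ 2 *
          (2 * (c * (log r / r)) + C * r⁻¹ + n * (2 * log 2 * r⁻¹ + log r / r))) atTop
          (𝓝 (2 / (1 - ‖w‖ * 0) ^ 2 * (2 * (c * 0) + C * 0 + n * (2 * log 2 * 0 + 0)))) := by
        refine Tendsto.mul (Tendsto.div tendsto_const_nhds
          ((tendsto_const_nhds.sub (hir.const_mul _)).pow 2) (by simp)) ?_
        exact (((hlr.const_mul c).const_mul 2).add (hir.const_mul C)).add
          (((hir.const_mul _).add hlr).const_mul n)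
      simp only [mul_zero, add_zero] at h1
      refine h1.congr' ?_
      filter_upwards [eventually_gt_atTop 0, eventually_gt_atTop ‖w‖] with r hr hrw
      have : r - ‖w‖ ≠ 0 := by linarith
      have h2 : 1 - ‖w‖ * r⁻¹ = (r - ‖w‖) / r := by field_simp
      rw [h2, hM]
      field_simp
    by_contra hcon
    have hpos : 0 < ‖logDeriv g w‖ := norm_pos_iff.2 hcon
    obtain ⟨r, h1, h2⟩ := (hbound.and_eventually (hlim.eventually_lt_const hpos)).exists
    linarith
  have hgd : Differentiable ℂ g := fun z => (hg z (mem_univ z)).differentiableAt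
  have hg' : ∀ z, deriv g z = 0 := fun z => by
    have := hderiv z
    rw [logDeriv_apply, div_eq_zero_iff] at this
    exact this.resolve_right (hne z (mem_univ z))
  have hgc : ∀ z, g z = g 0 := fun z => is_const_of_deriv_eq_zero hgd hg' z 0
  refine ⟨Polynomial.C (g 0) * ∏ u ∈ S, (Polynomial.X - Polynomial.C u) ^ (D u).toNat,
    ∏ u ∈ S, (Polynomial.X - Polynomial.C u) ^ (-D u).toNat,
    Finset.prod_ne_zero_iff.2 fun u _ => pow_ne_zero _ (Polynomial.X_sub_C_ne_zero u), ?_⟩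
  have hS' : ∀ᶠ z in codiscrete ℂ, ∀ u ∈ S, z ≠ u :=
    (Finset.eventually_all S).2 fun u _ => eventually_codiscreteWithin_ne u _
  filter_upwards [hfg, hS'] with z hz hzS
  rw [hz, hgc z, Polynomial.eval_mul, Polynomial.eval_C, Polynomial.eval_prod,
    Polynomial.eval_prod, mul_comm, mul_div_assoc, ← Finset.prod_div_distrib]
  congr 1
  refine Finset.prod_congr rfl fun u hu => ?_
  have hzu : z - u ≠ 0 := sub_ne_zero.2 (hzS u hu)
  simp only [Polynomial.eval_pow, Polynomial.eval_sub, Polynomial.eval_X, Polynomial.eval_C]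
  rw [← zpow_natCast, ← zpow_natCast, ← zpow_sub₀ hzu]
  congr 1
  exact (Int.toNat_sub_toNat_neg (D u)).symm

/-! ### Meromorphic functions up to codiscrete sets -/

lemma eventually_codiscrete_iff {p : ℂ → Prop} :
    (∀ᶠ z in codiscrete ℂ, p z) ↔ ∀ x, ∀ᶠ z in 𝓝[≠] x, p z := by
  rw [Filter.Eventually, mem_codiscrete]
  exact forall_congr' fun x => by rw [disjoint_principal_right, compl_compl]; rfl

lemma meromorphicOrderAt_ne_top_of_not_sameMero {g : ℂ → ℂ} (hg : Meromorphic g)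
    (h : ¬ SameMero g 0) (z : ℂ) : meromorphicOrderAt g z ≠ ⊤ := by
  refine hg.exists_meromorphicOrderAt_ne_top_iff_forall.1 ?_ z
  by_contra! hcon
  exact h (eventually_codiscrete_iff.2 fun x => meromorphicOrderAt_eq_top_iff.1 (hcon x))

lemma eventually_ne_zero_of_not_sameMero {g : ℂ → ℂ} (hg : Meromorphic g)
    (h : ¬ SameMero g 0) : ∀ᶠ z in codiscrete ℂ, g z ≠ 0 :=
  hg.meromorphicOn.eventually_codiscreteWithin_apply_ne_zero
    fun x _ => meromorphicOrderAt_ne_top_of_not_sameMero hg h x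

lemma sameMero_zero_of_meromorphicOrderAt_eq_top {g : ℂ → ℂ} (hg : Meromorphic g) {z : ℂ}
    (h : meromorphicOrderAt g z = ⊤) : SameMero g 0 := by
  by_contra hcon
  exact meromorphicOrderAt_ne_top_of_not_sameMero hg hcon z h

lemma eventually_analyticAt_codiscrete {g : ℂ → ℂ} (hg : Meromorphic g) :
    ∀ᶠ z in codiscrete ℂ, AnalyticAt ℂ g z :=
  hg.meromorphicOn.analyticAt_mem_codiscreteWithin

lemma SameMero.deriv {g h : ℂ → ℂ} (hg : Meromorphic g) (hh : Meromorphic h)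
    (H : SameMero g h) : SameMero (deriv g) (deriv h) :=
  hg.meromorphicOn.deriv_eventuallyEq_codiscreteWithin hh.meromorphicOn H

/-- A meromorphic function with vanishing derivative is constant: subtracting its value at a point
of analyticity gives a function whose order at that point can only be `⊤`. -/
lemma exists_sameMero_const_of_deriv {h : ℂ → ℂ} (hh : Meromorphic h)
    (hd : SameMero (deriv h) 0) : ∃ c : ℂ, SameMero h (fun _ => c) := by
  have : (codiscrete ℂ).NeBot := by
    rw [← forall_mem_nonempty_iff_neBot]
    intro s hs
    have : ∀ᶠ z in 𝓝[≠] (0 : ℂ), z ∈ s := eventually_codiscrete_iff.1 hs 0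
    exact this.exists
  obtain ⟨z₀, hz₀⟩ := (eventually_analyticAt_codiscrete hh).exists
  refine ⟨h z₀, ?_⟩
  set k : ℂ → ℂ := fun z => h z - h z₀ with hk
  have hkm : Meromorphic k := fun z => (hh z).fun_sub (MeromorphicAt.const _ _)
  have hka : AnalyticAt ℂ k z₀ := hz₀.fun_sub analyticAt_const
  have hkd : deriv k = deriv h := by
    funext z
    simp [hk]
  have hk0 : k z₀ = 0 := sub_self _
  have htop : meromorphicOrderAt k z₀ = ⊤ := by
    by_contra hne
    obtain ⟨n, hn⟩ := WithTop.ne_top_iff_exists.1 hne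
    have hn0 : n ≠ 0 := by
      rintro rfl
      have h1 : meromorphicOrderAt k z₀ = 0 := by rw [← hn]; rfl
      exact (hka.meromorphicNFAt.meromorphicOrderAt_eq_zero_iff.1 h1) hk0
    have h2 := meromorphicOrderAt_deriv_eq_sub_one (f := k) (x := z₀) (n := n)
      (by exact_mod_cast hn0) hn.symm
    have h3 : meromorphicOrderAt (deriv k) z₀ = ⊤ := by
      rw [hkd]
      exact meromorphicOrderAt_eq_top_iff.2 (eventually_codiscrete_iff.1 hd z₀)
    rw [h3] at h2
    exact WithTop.top_ne_coe h2
  filter_upwards [sameMero_zero_of_meromorphicOrderAt_eq_top hkm htop] with z hz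
  simpa [hk, sub_eq_zero] using hz

lemma poleSet_add_subset {g h : ℂ → ℂ} (hg : Meromorphic g) (hh : Meromorphic h) :
    poleSet (fun z => g z + h z) ⊆ poleSet g ∪ poleSet h := by
  intro z hz
  by_contra hcon
  simp only [poleSet, mem_union, mem_ofPred_eq, not_or, not_lt] at hcon hz
  exact absurd (hz.trans_le ((le_min hcon.1 hcon.2).trans (meromorphicOrderAt_add (hg z) (hh z))))
    (lt_irrefl _)

lemma poleSet_mul_subset {g h : ℂ → ℂ} (hg : Meromorphic g) (hh : Meromorphic h) :
    poleSet (fun z => g z * h z) ⊆ poleSet g ∪ poleSet h := by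
  intro z hz
  by_contra hcon
  simp only [poleSet, mem_union, mem_ofPred_eq, not_or, not_lt] at hcon hz
  rw [fun_meromorphicOrderAt_mul (hg z) (hh z)] at hz
  exact absurd hz (not_lt.2 (add_nonneg hcon.1 hcon.2))

lemma poleSet_deriv_subset {g : ℂ → ℂ} (hg : Meromorphic g) : poleSet (deriv g) ⊆ poleSet g := by
  intro z hz
  by_contra hcon
  simp only [poleSet, mem_ofPred_eq, not_lt] at hcon hz
  obtain ⟨h, hh, hgh⟩ := (hg z).meromorphicOrderAt_nonneg_iff.1 hcon
  refine absurd hz (not_lt.2 ((hg z).deriv.meromorphicOrderAt_nonneg_iff.2 ⟨deriv h, hh.deriv, ?_⟩))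
  exact hgh.nhdsNE_deriv

lemma poleSet_logDeriv_subset {g : ℂ → ℂ} (hg : Meromorphic g)
    (hord : ∀ z, meromorphicOrderAt g z ≠ ⊤) :
    poleSet (logDeriv g) ⊆ poleSet g ∪ zeroSet g := by
  intro z hz
  by_contra hcon
  simp only [poleSet, zeroSet, mem_union, mem_ofPred_eq, not_or, not_and, not_lt] at hcon hz
  have h0 : meromorphicOrderAt g z = 0 :=
    le_antisymm (not_lt.1 fun h => hcon.2 h (hord z)) hcon.1
  exact absurd hz (not_lt.2 (meromorphicOrderAt_logDeriv_nonneg (hg z) h0))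

/-! ### Growth of the characteristic -/

lemma logCounting_top_isBigO_log {g : ℂ → ℂ} (hg : Meromorphic g) (hp : (poleSet g).Finite) :
    logCounting g ⊤ =O[atTop] log := by
  rw [logCounting_isBigO_log_iff_finite_support]
  refine hp.subset fun z hz => ?_
  rw [Function.mem_support, Function.locallyFinsuppWithin.negPart_apply,
    MeromorphicOn.divisor_apply hg.meromorphicOn (mem_univ z)] at hz
  by_contra hcon
  simp only [poleSet, mem_ofPred_eq, not_lt] at hcon
  exact hz (negPart_eq_zero.2 (WithTop.untop₀_nonneg.2 hcon))

lemma log_isLittleO_nevT {f : ℂ → ℂ} (hf : IsTranscendentalMeromorphic f) :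
    log =o[atTop] nevT f := by
  have hord : ∀ z, meromorphicOrderAt f z ≠ ⊤ := by
    refine meromorphicOrderAt_ne_top_of_not_sameMero hf.1 fun h => hf.2 ⟨0, 1, one_ne_zero, ?_⟩
    filter_upwards [h] with z hz
    simpa using hz
  rw [isLittleO_iff]
  intro c hc
  by_contra hcon
  refine hf.2 (isRationalFunction_of_frequently_le_log hf.1 hord (c := c⁻¹) ?_)
  refine ((not_eventually.1 hcon).and_eventually (eventually_ge_atTop 1)).mono ?_
  rintro r ⟨h1, h2⟩
  rw [not_le, norm_of_nonneg (log_nonneg h2), nevT, norm_of_nonneg (characteristic_nonneg h2)] at h1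
  rw [inv_mul_eq_div, le_div_iff₀ hc]
  linarith

lemma tendsto_nevT_atTop {f : ℂ → ℂ} (hlog : log =o[atTop] nevT f) :
    Tendsto (nevT f) atTop atTop := by
  refine tendsto_atTop_mono' _ ?_ tendsto_log_atTop
  filter_upwards [hlog.bound one_pos, eventually_ge_atTop 1] with r h1 h2
  rwa [norm_of_nonneg (log_nonneg h2), nevT, norm_of_nonneg (characteristic_nonneg h2),
    one_mul] at h1

lemma isLittleO_of_nonneg_le {l : Filter ℝ} {u v T : ℝ → ℝ} (hv : v =o[l] T)
    (h : ∀ᶠ r in l, 0 ≤ u r ∧ u r ≤ v r) : u =o[l] T := by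
  refine IsBigO.trans_isLittleO (IsBigO.of_bound 1 ?_) hv
  filter_upwards [h] with r hr
  rw [norm_of_nonneg hr.1, one_mul]
  exact hr.2.trans (le_norm_self _)

lemma log_one_add_isLittleO {l : Filter ℝ} {S T : ℝ → ℝ} (hT : Tendsto T l atTop)
    (hS0 : ∀ᶠ r in l, 0 ≤ S r) (hS : S =O[l] T) : (fun r => log (1 + S r)) =o[l] T := by
  obtain ⟨K, hK, hb⟩ := hS.exists_pos
  have h1 : (fun x : ℝ => log (1 + K) + log x) =o[atTop] (id : ℝ → ℝ) :=
    (isLittleO_const_id_atTop _).add isLittleO_log_id_atTop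
  have h2 : (fun r => log (1 + K) + log (T r)) =o[l] T := h1.comp_tendsto hT
  refine isLittleO_of_nonneg_le h2 ?_
  filter_upwards [hS0, hb.bound, hT.eventually_ge_atTop 1] with r h0 hle hT1
  refine ⟨log_nonneg (by linarith), ?_⟩
  rw [norm_of_nonneg h0, norm_of_nonneg (by linarith)] at hle
  rw [← log_mul (by positivity) (by positivity)]
  exact log_le_log (by positivity) (by nlinarith)

/-! ### Growth of bounded degree in `f` -/

/-- `g` grows at most like `‖f‖ ^ d` on the set where `f` is large and like a constant where `f`
is bounded, up to a factor that is negligible in the sense of Nevanlinna theory: the factor `e ^ u`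
has mean logarithm `o(T(r, f))`. Differential polynomials of degree at most `d` with small
coefficients have this property. -/
def GrowthLE (f : ℂ → ℂ) (d : ℕ) (g : ℂ → ℂ) : Prop :=
  ∃ u : ℂ → ℝ, (∀ z, 0 ≤ u z) ∧ (∀ r, CircleIntegrable u 0 r) ∧
    (fun r => circleAverage u 0 r) =o[nevFilter] nevT f ∧
    ∀ᶠ z in codiscrete ℂ, log⁺ ‖g z‖ ≤ u z + d * log⁺ ‖f z‖

lemma GrowthLE.congr {f g h : ℂ → ℂ} {d : ℕ} (hg : GrowthLE f d g) (H : SameMero g h) :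
    GrowthLE f d h := by
  obtain ⟨u, h0, hi, ho, hb⟩ := hg
  refine ⟨u, h0, hi, ho, ?_⟩
  filter_upwards [hb, H] with z hz hzH
  rwa [← hzH]

lemma GrowthLE.mono {f g : ℂ → ℂ} {d e : ℕ} (hg : GrowthLE f d g) (hde : d ≤ e) :
    GrowthLE f e g := by
  obtain ⟨u, h0, hi, ho, hb⟩ := hg
  refine ⟨u, h0, hi, ho, ?_⟩
  filter_upwards [hb] with z hz
  refine hz.trans ?_
  gcongr
  exact posLog_nonneg

lemma growthLE_zero_of_proximity {f g : ℂ → ℂ} (hg : Meromorphic g)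
    (h : proximity g ⊤ =o[nevFilter] nevT f) : GrowthLE f 0 g := by
  refine ⟨fun z => log⁺ ‖g z‖, fun z => posLog_nonneg,
    fun r => hg.meromorphicOn.circleIntegrable_posLog_norm, ?_, ?_⟩
  · simpa [proximity_top] using h
  · exact Eventually.of_forall fun z => by simp

lemma growthLE_const {f : ℂ → ℂ} (hT : Tendsto (nevT f) nevFilter atTop) (c : ℂ) :
    GrowthLE f 0 (fun _ => c) := by
  refine growthLE_zero_of_proximity (fun z => by fun_prop) ?_
  have : proximity (fun _ : ℂ => c) ⊤ = fun _ => log⁺ ‖c‖ := funext fun r => proximity_const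
  rw [this]
  exact isLittleO_const_left.2 (Or.inr (tendsto_norm_atTop_atTop.comp hT))

lemma growthLE_self (f : ℂ → ℂ) : GrowthLE f 1 f := by
  refine ⟨fun _ => 0, fun _ => le_rfl, fun r => circleIntegrable_const _ _ _, ?_, ?_⟩
  · simp only [circleAverage_const]
    exact isLittleO_zero _ _
  · exact Eventually.of_forall fun z => by simp

lemma GrowthLE.add {f g h : ℂ → ℂ} {d : ℕ} (hT : Tendsto (nevT f) nevFilter atTop)
    (hg : GrowthLE f d g) (hh : GrowthLE f d h) : GrowthLE f d (fun z => g z + h z) := by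
  obtain ⟨u, u0, ui, uo, ub⟩ := hg
  obtain ⟨v, v0, vi, vo, vb⟩ := hh
  have hc : ∀ r, CircleIntegrable (fun _ : ℂ => log 2) 0 r := fun r => circleIntegrable_const _ _ _
  have hl2 : 0 ≤ log 2 := log_nonneg one_le_two
  refine ⟨fun z => log 2 + (u z + v z), fun z => add_nonneg hl2 (add_nonneg (u0 z) (v0 z)),
    fun r => (hc r).add ((ui r).add (vi r)), ?_, ?_⟩
  · have heq : (fun r => circleAverage (fun z => log 2 + (u z + v z)) 0 r) =
        fun r => log 2 + (circleAverage u 0 r + circleAverage v 0 r) := by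
      funext r
      rw [circleAverage_fun_add (f₂ := fun z => u z + v z) (hc r) ((ui r).add (vi r)),
        circleAverage_fun_add (ui r) (vi r), circleAverage_const]
    rw [heq]
    exact (isLittleO_const_left.2 (Or.inr (tendsto_norm_atTop_atTop.comp hT))).add (uo.add vo)
  · filter_upwards [ub, vb] with z hu hv
    -- `‖g + h‖ ≤ 2 max ‖g‖ ‖h‖`, so the degrees do not add up
    set M := max ‖g z‖ ‖h z‖ with hM
    have h1 : ‖g z + h z‖ ≤ 2 * M :=
      (norm_add_le _ _).trans (by linarith [le_max_left ‖g z‖ ‖h z‖, le_max_right ‖g z‖ ‖h z‖])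
    have h2 := (posLog_le_posLog (norm_nonneg _) h1).trans posLog_mul
    have h3 : log⁺ M ≤ u z + v z + d * log⁺ ‖f z‖ := by
      rcases max_choice ‖g z‖ ‖h z‖ with h | h
      · rw [hM, h]; linarith [v0 z]
      · rw [hM, h]; linarith [u0 z]
    have h4 : log⁺ (2 : ℝ) = log 2 := posLog_eq_log (by norm_num)
    rw [h4] at h2
    linarith

lemma GrowthLE.mul {f g h : ℂ → ℂ} {d e : ℕ}
    (hg : GrowthLE f d g) (hh : GrowthLE f e h) : GrowthLE f (d + e) (fun z => g z * h z) := by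
  obtain ⟨u, u0, ui, uo, ub⟩ := hg
  obtain ⟨v, v0, vi, vo, vb⟩ := hh
  refine ⟨fun z => u z + v z, fun z => add_nonneg (u0 z) (v0 z),
    fun r => (ui r).add (vi r), ?_, ?_⟩
  · have heq : (fun r => circleAverage (fun z => u z + v z) 0 r) =
        fun r => circleAverage u 0 r + circleAverage v 0 r :=
      funext fun r => circleAverage_fun_add (ui r) (vi r)
    rw [heq]
    exact uo.add vo
  · filter_upwards [ub, vb] with z hu hv
    rw [norm_mul]
    refine posLog_mul.trans ?_
    push_cast
    linarith

lemma GrowthLE.proximity_isLittleO {f g : ℂ → ℂ} (hgm : Meromorphic g) (hg : GrowthLE f 0 g) :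
    proximity g ⊤ =o[nevFilter] nevT f := by
  obtain ⟨u, u0, ui, uo, ub⟩ := hg
  refine isLittleO_of_nonneg_le uo ?_
  filter_upwards [nevFilter_le_atTop (eventually_gt_atTop 0)] with r hr
  refine ⟨proximity_nonneg r, ?_⟩
  rw [proximity_top]
  refine circleAverage_mono_codiscreteWithin hgm.meromorphicOn.circleIntegrable_posLog_norm (ui r)
    (ne_of_gt hr) ?_
  filter_upwards [ub.filter_mono (codiscreteWithin_mono (subset_univ _))] with z hz
  simpa using hz

/-- **Clunie's lemma.** If `f ^ d * X` grows at most like `‖f‖ ^ d` and `X` has bounded degree, then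
`X` is small: where `‖f‖ ≤ 1` the bound on `X` applies, elsewhere the one on the product. -/
lemma GrowthLE.of_pow_mul {f X D : ℂ → ℂ} {d e : ℕ} (hX : GrowthLE f e X) (hD : GrowthLE f d D)
    (h : SameMero (fun z => f z ^ d * X z) D) : GrowthLE f 0 X := by
  obtain ⟨u, u0, ui, uo, ub⟩ := hX
  obtain ⟨v, v0, vi, vo, vb⟩ := hD
  refine ⟨fun z => u z + v z, fun z => add_nonneg (u0 z) (v0 z),
    fun r => (ui r).add (vi r), ?_, ?_⟩
  · have heq : (fun r => circleAverage (fun z => u z + v z) 0 r) =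
        fun r => circleAverage u 0 r + circleAverage v 0 r :=
      funext fun r => circleAverage_fun_add (ui r) (vi r)
    rw [heq]
    exact uo.add vo
  · filter_upwards [ub, vb, h] with z hu hv hz
    have hu0 := u0 z
    have hv0 := v0 z
    simp only [Nat.cast_zero, zero_mul, add_zero]
    rcases le_total ‖f z‖ 1 with hf1 | hf1
    · have h0 : log⁺ ‖f z‖ = 0 := (posLog_eq_zero_iff _).2 (by rwa [abs_of_nonneg (norm_nonneg _)])
      rw [h0, mul_zero, add_zero] at hu
      linarith
    · rcases le_total ‖X z‖ 1 with hX1 | hX1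
      · have h0 : log⁺ ‖X z‖ = 0 :=
          (posLog_eq_zero_iff _).2 (by rwa [abs_of_nonneg (norm_nonneg _)])
        linarith
      · have hfl : log⁺ ‖f z‖ = log ‖f z‖ := posLog_eq_log (by rwa [abs_of_nonneg (norm_nonneg _)])
        have hXl : log⁺ ‖X z‖ = log ‖X z‖ := posLog_eq_log (by rwa [abs_of_nonneg (norm_nonneg _)])
        have hDn : ‖D z‖ = ‖f z‖ ^ d * ‖X z‖ := by rw [← hz, norm_mul, norm_pow]
        have hD1 : 1 ≤ ‖D z‖ := by
          rw [hDn]; exact one_le_mul_of_one_le_of_one_le (one_le_pow₀ hf1) hX1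
        have hDl : log⁺ ‖D z‖ = log ‖D z‖ := posLog_eq_log (by rwa [abs_of_nonneg (norm_nonneg _)])
        rw [hDl, hDn, log_mul (by positivity) (by positivity), log_pow, hfl] at hv
        rw [hXl]
        linarith

/-! ### Differential polynomials of bounded degree in `f` -/

/-- Meromorphic functions with finitely many poles that behave like a differential polynomial in `f`
of degree at most `d` with small coefficients. -/
structure DegreeLE (f : ℂ → ℂ) (d : ℕ) (g : ℂ → ℂ) : Prop where
  meromorphic : Meromorphic g
  finite_poles : (poleSet g).Finite
  growth : GrowthLE f d g

lemma nevT_small_isLittleO {f y : ℂ → ℂ} (hy : IsSmallFunction f y) :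
    nevT y =o[nevFilter] nevT f := by
  obtain ⟨-, E, -, hE, ho⟩ := hy
  exact ho.mono (inf_le_inf_left _
    (le_principal_iff.2 (Measure.compl_mem_cofinite.2 hE)))

lemma DegreeLE.of_mem_classS0 {f y : ℂ → ℂ} (hy : y ∈ ClassS0 f) : DegreeLE f 0 y := by
  refine ⟨hy.1.1, hy.2.2, growthLE_zero_of_proximity hy.1.1 ?_⟩
  refine isLittleO_of_nonneg_le (nevT_small_isLittleO hy.1) ?_
  filter_upwards [nevFilter_le_atTop (eventually_ge_atTop 1)] with r hr
  exact ⟨proximity_nonneg r, proximity_le_characteristic y hr⟩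

lemma DegreeLE.mono {f g : ℂ → ℂ} {d e : ℕ} (hg : DegreeLE f d g) (hde : d ≤ e) :
    DegreeLE f e g :=
  ⟨hg.1, hg.2, hg.3.mono hde⟩

lemma degreeLE_const {f : ℂ → ℂ} (hT : Tendsto (nevT f) nevFilter atTop) (c : ℂ) :
    DegreeLE f 0 (fun _ => c) := by
  refine ⟨fun z => by fun_prop, ?_, growthLE_const hT c⟩
  convert Set.finite_empty (α := ℂ)
  refine eq_empty_of_forall_notMem fun z hz => ?_
  exact absurd hz (not_lt.2 (analyticAt_const (v := c)).meromorphicOrderAt_nonneg)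

lemma DegreeLE.add {f g h : ℂ → ℂ} {d : ℕ} (hT : Tendsto (nevT f) nevFilter atTop)
    (hg : DegreeLE f d g) (hh : DegreeLE f d h) : DegreeLE f d (fun z => g z + h z) :=
  ⟨fun z => (hg.1 z).fun_add (hh.1 z),
    (hg.2.union hh.2).subset (poleSet_add_subset hg.1 hh.1), hg.3.add hT hh.3⟩

lemma DegreeLE.mul {f g h : ℂ → ℂ} {d e : ℕ}
    (hg : DegreeLE f d g) (hh : DegreeLE f e h) : DegreeLE f (d + e) (fun z => g z * h z) :=
  ⟨fun z => (hg.1 z).fun_mul (hh.1 z),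
    (hg.2.union hh.2).subset (poleSet_mul_subset hg.1 hh.1), hg.3.mul hh.3⟩

lemma DegreeLE.const_mul {f g : ℂ → ℂ} {d : ℕ} (hT : Tendsto (nevT f) nevFilter atTop)
    (c : ℂ) (hg : DegreeLE f d g) : DegreeLE f d (fun z => c * g z) := by
  simpa using (degreeLE_const hT c).mul hg

lemma DegreeLE.sub {f g h : ℂ → ℂ} {d : ℕ} (hT : Tendsto (nevT f) nevFilter atTop)
    (hg : DegreeLE f d g) (hh : DegreeLE f d h) : DegreeLE f d (fun z => g z - h z) := by
  simpa [sub_eq_add_neg] using hg.add hT (hh.const_mul hT (-1))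

lemma DegreeLE.pow {f g : ℂ → ℂ} {d : ℕ} (hT : Tendsto (nevT f) nevFilter atTop)
    (hg : DegreeLE f d g) (n : ℕ) : DegreeLE f (n * d) (fun z => g z ^ n) := by
  induction n with
  | zero => simpa using degreeLE_const hT 1
  | succ n ih => simpa [pow_succ, Nat.succ_mul] using ih.mul hg

lemma DegreeLE.sum {ι : Type*} {f : ℂ → ℂ} {d : ℕ} (hT : Tendsto (nevT f) nevFilter atTop)
    {s : Finset ι} {g : ι → ℂ → ℂ} (hg : ∀ i ∈ s, DegreeLE f d (g i)) :
    DegreeLE f d (fun z => ∑ i ∈ s, g i z) := by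
  classical
  induction s using Finset.induction_on with
  | empty => simpa using (degreeLE_const hT 0).mono (Nat.zero_le d)
  | insert i s hi ih =>
    simp only [Finset.sum_insert hi]
    exact (hg i (Finset.mem_insert_self _ _)).add hT
      (ih fun j hj => hg j (Finset.mem_insert_of_mem hj))

lemma DegreeLE.prod {ι : Type*} {f : ℂ → ℂ} (hT : Tendsto (nevT f) nevFilter atTop)
    {s : Finset ι} {d : ι → ℕ} {g : ι → ℂ → ℂ} (hg : ∀ i ∈ s, DegreeLE f (d i) (g i)) :
    DegreeLE f (∑ i ∈ s, d i) (fun z => ∏ i ∈ s, g i z) := by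
  classical
  induction s using Finset.induction_on with
  | empty => simpa using degreeLE_const hT 1
  | insert i s hi ih =>
    simp only [Finset.prod_insert hi, Finset.sum_insert hi]
    exact (hg i (Finset.mem_insert_self _ _)).mul
      (ih fun j hj => hg j (Finset.mem_insert_of_mem hj))

lemma nevT_isBigO {f g : ℂ → ℂ} {d : ℕ} (hf : f ∈ ClassN0) (hlog : log =o[atTop] nevT f)
    (hg : DegreeLE f d g) : nevT g =O[nevFilter] nevT f := by
  obtain ⟨u, u0, ui, uo, ub⟩ := hg.growth
  have hN : logCounting g ⊤ =o[nevFilter] nevT f :=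
    ((logCounting_top_isBigO_log hg.1 hg.2).trans_isLittleO hlog).mono nevFilter_le_atTop
  have hsum : (fun r => circleAverage u 0 r + d * nevT f r + logCounting g ⊤ r)
      =O[nevFilter] nevT f :=
    (uo.isBigO.add (isBigO_const_mul_self _ _ _)).add hN.isBigO
  refine IsBigO.trans (IsBigO.of_bound 1 ?_) hsum
  filter_upwards [nevFilter_le_atTop (eventually_ge_atTop 1)] with r hr
  have hint : CircleIntegrable (fun z => log⁺ ‖f z‖) 0 r :=
    hf.1.meromorphicOn.circleIntegrable_posLog_norm
  have hintd : CircleIntegrable (fun z => (d : ℝ) * log⁺ ‖f z‖) 0 r := hint.const_mul _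
  have h1 : proximity g ⊤ r ≤ circleAverage u 0 r + d * proximity f ⊤ r := by
    rw [proximity_top, proximity_top]
    have h2 : circleAverage (fun z => (d : ℝ) * log⁺ ‖f z‖) 0 r
        = d * circleAverage (fun z => log⁺ ‖f z‖) 0 r := circleAverage_fun_smul (a := (d : ℝ))
    rw [← h2, ← circleAverage_fun_add (ui r) hintd]
    exact circleAverage_mono_codiscreteWithin hg.1.meromorphicOn.circleIntegrable_posLog_norm
      ((ui r).add hintd) (by linarith)
      (ub.filter_mono (codiscreteWithin_mono (subset_univ _)))
  have h3 : proximity f ⊤ r ≤ nevT f r := proximity_le_characteristic f hr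
  have h4 : (d : ℝ) * proximity f ⊤ r ≤ d * nevT f r := by gcongr
  rw [one_mul, nevT, norm_of_nonneg (characteristic_nonneg hr)]
  refine le_trans ?_ (le_norm_self _)
  rw [characteristic, Pi.add_apply]
  linarith

lemma proximity_logDeriv_isLittleO {f g : ℂ → ℂ} {d : ℕ} (hf : f ∈ ClassN0)
    (hlog : log =o[atTop] nevT f) (hg : DegreeLE f d g) (h0 : ¬ SameMero g 0) :
    proximity (logDeriv g) ⊤ =o[nevFilter] nevT f := by
  have hT : Tendsto (nevT f) nevFilter atTop :=
    (tendsto_nevT_atTop hlog).mono_left nevFilter_le_atTop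
  obtain ⟨C, hC⟩ := exists_eventually_proximity_logDeriv_le hg.1
    (meromorphicOrderAt_ne_top_of_not_sameMero hg.1 h0)
  have hnn : ∀ᶠ r in nevFilter, 0 ≤ nevT g r := by
    filter_upwards [nevFilter_le_atTop (eventually_ge_atTop 1)] with r hr
    exact characteristic_nonneg hr
  have h1 := log_one_add_isLittleO hT hnn (nevT_isBigO hf hlog hg)
  have h2 : (fun _ : ℝ => C) =o[nevFilter] nevT f :=
    isLittleO_const_left.2 (Or.inr (tendsto_norm_atTop_atTop.comp hT))
  refine isLittleO_of_nonneg_le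
    ((h2.add ((hlog.mono nevFilter_le_atTop).const_mul_left 5)).add (h1.const_mul_left 8)) ?_
  filter_upwards [hC] with r hr
  exact ⟨proximity_nonneg r, hr⟩

/-- Derivatives do not raise the degree: `g' = g * (g' / g)`, and the second factor is small by the
lemma on the logarithmic derivative. -/
lemma DegreeLE.deriv {f g : ℂ → ℂ} {d : ℕ} (hf : f ∈ ClassN0) (hlog : log =o[atTop] nevT f)
    (hg : DegreeLE f d g) : DegreeLE f d (deriv g) := by
  have hT : Tendsto (nevT f) nevFilter atTop :=
    (tendsto_nevT_atTop hlog).mono_left nevFilter_le_atTop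
  refine ⟨hg.1.deriv, hg.2.subset (poleSet_deriv_subset hg.1), ?_⟩
  by_cases h0 : SameMero g 0
  · have h1 : SameMero (_root_.deriv g) (_root_.deriv 0) :=
      SameMero.deriv hg.1 (MeromorphicOn.const 0 (U := univ) · (mem_univ _)) h0
    refine ((growthLE_const hT 0).mono (Nat.zero_le d)).congr ?_
    filter_upwards [h1] with z hz
    rw [hz]
    simp
  · refine (hg.3.mul (growthLE_zero_of_proximity (hg.1.deriv.div hg.1)
      (proximity_logDeriv_isLittleO hf hlog hg h0))).congr ?_
    filter_upwards [eventually_ne_zero_of_not_sameMero hg.1 h0] with z hz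
    rw [Pi.div_apply, mul_div_cancel₀ _ hz]

lemma DegreeLE.iteratedDeriv {f : ℂ → ℂ} (hf : f ∈ ClassN0) (hlog : log =o[atTop] nevT f)
    (n : ℕ) : DegreeLE f 1 (iteratedDeriv n f) := by
  induction n with
  | zero => simpa using ⟨hf.1, hf.2, growthLE_self f⟩
  | succ n ih => rw [iteratedDeriv_succ]; exact ih.deriv hf hlog

/-! ### Clunie's argument -/

/-- The contradiction that drives the proof: if `f ^ (d + 1) * X` had degree at most `d`, then
`X` and `f * X` would both be small by Clunie's lemma, and so would be `f = (f * X) / X`. -/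
lemma sameMero_zero_of_pow_succ_mul {f X D : ℂ → ℂ} {d e : ℕ} (hf : f ∈ ClassN0)
    (hlog : log =o[atTop] nevT f) (hX : DegreeLE f e X) (hD : GrowthLE f d D)
    (h : SameMero (fun z => f z ^ (d + 1) * X z) D) : SameMero X 0 := by
  by_contra hX0
  have hT : Tendsto (nevT f) nevFilter atTop :=
    (tendsto_nevT_atTop hlog).mono_left nevFilter_le_atTop
  have hlog' : log =o[nevFilter] nevT f := hlog.mono nevFilter_le_atTop
  have hXs := (hX.3.of_pow_mul (hD.mono (Nat.le_succ d)) h).proximity_isLittleO hX.1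
  set Y : ℂ → ℂ := fun z => f z * X z with hY
  have hYm : Meromorphic Y := fun z => (hf.1 z).fun_mul (hX.1 z)
  have hYs : proximity Y ⊤ =o[nevFilter] nevT f := by
    refine GrowthLE.proximity_isLittleO hYm
      (GrowthLE.of_pow_mul (X := Y) ((growthLE_self f).mul hX.3) hD ?_)
    filter_upwards [h] with z hz
    rw [← hz, hY, pow_succ, mul_assoc]
  have hNX : logCounting X ⊤ =o[nevFilter] nevT f :=
    ((logCounting_top_isBigO_log hX.1 hX.2).mono nevFilter_le_atTop).trans_isLittleO hlog'
  have hNf : logCounting f ⊤ =o[nevFilter] nevT f :=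
    ((logCounting_top_isBigO_log hf.1 hf.2).mono nevFilter_le_atTop).trans_isLittleO hlog'
  obtain ⟨C, -, hC⟩ := exists_characteristic_inv_le hX.1
  have hCo : (fun _ : ℝ => C) =o[nevFilter] nevT f :=
    isLittleO_const_left.2 (Or.inr (tendsto_norm_atTop_atTop.comp hT))
  have hTo : nevT f =o[nevFilter] nevT f := by
    refine isLittleO_of_nonneg_le ((((hYs.add hXs).add hNX).add hCo).add hNf) ?_
    filter_upwards [nevFilter_le_atTop (eventually_ge_atTop 1)] with r hr
    refine ⟨characteristic_nonneg hr, ?_⟩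
    have h1 : proximity f ⊤ r ≤ proximity Y ⊤ r + proximity X⁻¹ ⊤ r := by
      have h2 : f =ᶠ[codiscrete ℂ] Y * X⁻¹ := by
        filter_upwards [eventually_ne_zero_of_not_sameMero hX.1 hX0] with z hz
        simp [hY, hz]
      rw [proximity_congr_codiscrete h2 (by linarith)]
      exact proximity_mul_top_le hYm hX.1.inv r
    have h3 := proximity_le_characteristic X⁻¹ hr
    have h4 := hC r
    have h5 : characteristic X ⊤ r = proximity X ⊤ r + logCounting X ⊤ r := rfl
    have h6 : nevT f r = proximity f ⊤ r + logCounting f ⊤ r := rfl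
    linarith
  have h1 := hTo.bound (show (0 : ℝ) < 1 / 2 by norm_num)
  obtain ⟨r, h2, h3⟩ := (h1.and (hT.eventually_gt_atTop 0)).exists
  rw [norm_of_nonneg h3.le] at h2
  linarith

/-- The cofactor `∑ b_j f ^ (j - m)` of `f ^ m` in `P(z, f)`. -/
noncomputable def polyCofactor (m n : ℕ) (b : ℕ → ℂ → ℂ) (f : ℂ → ℂ) : ℂ → ℂ :=
  fun z => ∑ j ∈ Finset.Icc m n, b j z * f z ^ (j - m)

lemma polyAt_eq (m n : ℕ) (b : ℕ → ℂ → ℂ) (f : ℂ → ℂ) (z : ℂ) :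
    polyAt m n b f z = f z ^ m * polyCofactor m n b f z := by
  rw [polyAt, polyCofactor, Finset.mul_sum]
  refine Finset.sum_congr rfl fun j hj => ?_
  rw [mul_left_comm, ← pow_add, Nat.add_sub_cancel' (Finset.mem_Icc.1 hj).1]

lemma polyCofactor_eq {m n : ℕ} (hmn : m ≤ n) (b : ℕ → ℂ → ℂ) (f : ℂ → ℂ) (z : ℂ) :
    polyCofactor m n b f z = b m z + f z * polyCofactor (m + 1) n b f z := by
  rw [polyCofactor, ← Finset.insert_Icc_add_one_left_eq_Icc hmn, Finset.sum_insert (by simp),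
    polyCofactor, Finset.mul_sum]
  congr 1
  · simp
  · refine Finset.sum_congr rfl fun j hj => ?_
    have hj := (Finset.mem_Icc.1 hj).1
    rw [mul_left_comm, ← pow_succ', show j - (m + 1) + 1 = j - m by omega]

lemma DegreeLE.polyCofactor {f : ℂ → ℂ} (hf : f ∈ ClassN0)
    (hT : Tendsto (nevT f) nevFilter atTop) {m n : ℕ} {b : ℕ → ℂ → ℂ}
    (hb : ∀ j, m ≤ j → j ≤ n → b j ∈ ClassS0 f) :
    DegreeLE f n (polyCofactor m n b f) := by
  refine DegreeLE.sum hT fun j hj => ?_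
  have hj := Finset.mem_Icc.1 hj
  have h1 : DegreeLE f 1 f := ⟨hf.1, hf.2, growthLE_self f⟩
  exact ((DegreeLE.of_mem_classS0 (hb j hj.1 hj.2)).mul (h1.pow hT (j - m))).mono (by omega)

lemma not_sameMero_polyCofactor {f : ℂ → ℂ} (hf : f ∈ ClassN0) (hlog : log =o[atTop] nevT f)
    {m n : ℕ} (hmn : m ≤ n) {b : ℕ → ℂ → ℂ} (hb : ∀ j, m ≤ j → j ≤ n → b j ∈ ClassS0 f)
    (hbm : ¬ SameMero (b m) 0) : ¬ SameMero (polyCofactor m n b f) 0 := by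
  intro h
  have hT : Tendsto (nevT f) nevFilter atTop :=
    (tendsto_nevT_atTop hlog).mono_left nevFilter_le_atTop
  have hX : DegreeLE f n (polyCofactor (m + 1) n b f) :=
    DegreeLE.polyCofactor hf hT fun j hj => hb j (by omega)
  have hD := ((DegreeLE.of_mem_classS0 (hb m le_rfl hmn)).const_mul hT (-1)).growth
  have h0 := sameMero_zero_of_pow_succ_mul (d := 0) hf hlog hX hD (by
    filter_upwards [h] with z hz
    rw [polyCofactor_eq hmn, Pi.zero_apply] at hz
    rw [zero_add, pow_one]
    linear_combination hz)
  refine hbm ?_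
  filter_upwards [h, h0] with z hz hz0
  rw [polyCofactor_eq hmn, hz0] at hz
  simpa using hz

lemma DegreeLE.diffPolyAt {f : ℂ → ℂ} (hf : f ∈ ClassN0) (hlog : log =o[atTop] nevT f)
    {q k : ℕ} {a : (Fin (q + 1) → ℕ) → ℂ → ℂ}
    (ha : ∀ I : Fin (q + 1) → ℕ, ∑ i, I i ≤ k → a I ∈ ClassS0 f) :
    DegreeLE f k (diffPolyAt q k a f) := by
  have hT : Tendsto (nevT f) nevFilter atTop :=
    (tendsto_nevT_atTop hlog).mono_left nevFilter_le_atTop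
  refine DegreeLE.sum hT fun d hd => DegreeLE.sum hT fun I hI => ?_
  have hd : d ≤ k := Nat.lt_succ_iff.1 (Finset.mem_range.1 hd)
  have hI : ∑ i, I i = d := (Finset.mem_piAntidiag.1 hI).1
  have hprod : DegreeLE f (∑ i, I i * 1)
      (fun z => ∏ i : Fin (q + 1), _root_.iteratedDeriv (i : ℕ) f z ^ I i) :=
    DegreeLE.prod hT fun (i : Fin (q + 1)) _ =>
      (DegreeLE.iteratedDeriv hf hlog (i : ℕ)).pow hT (I i)
  refine ((DegreeLE.of_mem_classS0 (ha I (hI.trans_le hd))).mul hprod).mono ?_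
  simpa [hI] using hd

end NevanlinnaSmall

open NevanlinnaSmall in
theorem theorem1p7 (m n q k : ℕ) (hmn : m ≤ n) (f : ℂ → ℂ)
    (hf : NevanlinnaSmall.IsTranscendentalMeromorphic f)
    (hfN : f ∈ NevanlinnaSmall.ClassN0)
    (b : ℕ → ℂ → ℂ)
    (hb : ∀ j, m ≤ j → j ≤ n → b j ∈ NevanlinnaSmall.ClassS0 f)
    (hbm : ¬ NevanlinnaSmall.SameMero (b m) 0)
    (a : (Fin (q + 1) → ℕ) → ℂ → ℂ)
    (ha : ∀ I : Fin (q + 1) → ℕ, ∑ i, I i ≤ k → a I ∈ NevanlinnaSmall.ClassS0 f)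
    (hL : ¬ NevanlinnaSmall.SameMero (NevanlinnaSmall.diffPolyAt q k a f) 0)
    (hmk : k + 2 ≤ m) :
    (NevanlinnaSmall.zeroSet
      (NevanlinnaSmall.polyAt m n b f + NevanlinnaSmall.diffPolyAt q k a f)).Infinite := by
  have hlog := log_isLittleO_nevT hf
  have hT : Tendsto (nevT f) nevFilter atTop :=
    (tendsto_nevT_atTop hlog).mono_left nevFilter_le_atTop
  have hfD : DegreeLE f 1 f := ⟨hfN.1, hfN.2, growthLE_self f⟩
  obtain ⟨p, rfl⟩ : ∃ p, m = p + 2 := ⟨m - 2, by omega⟩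
  set R := polyCofactor (p + 2) n b f with hR
  set L := diffPolyAt q k a f with hLdef
  set P := polyAt (p + 2) n b f with hP
  have hRD : DegreeLE f n R := DegreeLE.polyCofactor hfN hT hb
  have hLD : DegreeLE f k L := DegreeLE.diffPolyAt hfN hlog ha
  have hPz : ∀ z, P z = f z ^ (p + 2) * R z := polyAt_eq _ _ _ _
  have hPD : DegreeLE f ((p + 2) * 1 + n) P := by
    have := (hfD.pow hT (p + 2)).mul hRD
    rwa [← funext hPz] at this
  have hR0 : ¬ SameMero R 0 := not_sameMero_polyCofactor hfN hlog hmn hb hbm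
  -- `P` and `L` are not proportional, as `P = f ^ m * R` with `m` larger than the degree of `L`
  have hprop : ∀ c : ℂ, ¬ SameMero P (fun z => c * L z) := by
    intro c hc
    refine hR0 (sameMero_zero_of_pow_succ_mul (d := p + 1) hfN hlog hRD
      ((hLD.const_mul hT c).growth.mono (by omega)) ?_)
    filter_upwards [hc] with z hz
    rw [← hz, hPz]
  intro hfin
  set F := P + L with hF
  have hFD : DegreeLE f ((p + 2) * 1 + n + k) F :=
    (hPD.mono (by omega)).add hT (hLD.mono (by omega))
  have hF0 : ¬ SameMero F 0 := by
    intro h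
    refine hprop (-1) ?_
    filter_upwards [h] with z hz
    rw [hF, Pi.add_apply, Pi.zero_apply] at hz
    linear_combination hz
  set φ := logDeriv F with hφ
  have hφD : DegreeLE f 0 φ := by
    have hm : Meromorphic φ := hFD.1.deriv.div hFD.1
    refine ⟨hm, (hFD.2.union hfin).subset (poleSet_logDeriv_subset hFD.1
      (meromorphicOrderAt_ne_top_of_not_sameMero hFD.1 hF0)), growthLE_zero_of_proximity hm ?_⟩
    exact proximity_logDeriv_isLittleO hfN hlog hFD hF0
  -- `P' - φ P = φ L - L'`, because `F' = φ F`
  have hkey : ∀ᶠ z in codiscrete ℂ, deriv P z - φ z * P z = φ z * L z - deriv L z := by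
    filter_upwards [eventually_ne_zero_of_not_sameMero hFD.1 hF0,
      eventually_analyticAt_codiscrete hPD.1, eventually_analyticAt_codiscrete hLD.1]
      with z hz hPa hLa
    have h1 : deriv F z = deriv P z + deriv L z :=
      deriv_add hPa.differentiableAt hLa.differentiableAt
    have h2 : φ z * F z = deriv F z := by
      rw [hφ, logDeriv_apply, div_mul_cancel₀ _ hz]
    rw [h1, hF, Pi.add_apply] at h2
    linear_combination -h2
  set Q : ℂ → ℂ := fun z => ((p + 2 : ℕ) : ℂ) * (deriv f z * R z) + f z * deriv R z
    - φ z * (f z * R z) with hQ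
  have hQD : DegreeLE f (1 + n) Q := by
    refine DegreeLE.sub hT (DegreeLE.add hT (DegreeLE.const_mul hT _
      ((hfD.deriv hfN hlog).mul hRD)) (hfD.mul (hRD.deriv hfN hlog))) ?_
    exact (hφD.mul (hfD.mul hRD)).mono (by omega)
  have hPQ : ∀ᶠ z in codiscrete ℂ, f z ^ (p + 1) * Q z = deriv P z - φ z * P z := by
    filter_upwards [eventually_analyticAt_codiscrete hfN.1,
      eventually_analyticAt_codiscrete hRD.1] with z hfa hRa
    have h1 : deriv P z = ((p + 2 : ℕ) : ℂ) * f z ^ (p + 1) * deriv f z * R z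
        + f z ^ (p + 2) * deriv R z := by
      rw [funext hPz, deriv_fun_mul (hfa.differentiableAt.fun_pow _) hRa.differentiableAt,
        deriv_fun_pow hfa.differentiableAt]
      rfl
    rw [h1, hPz, hQ]
    ring
  have hQ0 : SameMero Q 0 := by
    refine sameMero_zero_of_pow_succ_mul (d := p) (D := fun z => φ z * L z - deriv L z) hfN hlog
      hQD ?_ ?_
    · exact (DegreeLE.sub hT ((hφD.mul hLD).mono (by omega))
        ((hLD.deriv hfN hlog).mono (by omega))).growth
    · filter_upwards [hPQ, hkey] with z h1 h2
      rw [h1, h2]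
  -- hence `P' = φ P` and `L' = φ L`, so that `P / L` is constant
  have hPLm : Meromorphic (P / L) := hPD.1.div hLD.1
  have hL0 := eventually_ne_zero_of_not_sameMero hLD.1 hL
  obtain ⟨c, hc⟩ := exists_sameMero_const_of_deriv hPLm (by
    filter_upwards [hPQ, hkey, hQ0, hL0, eventually_analyticAt_codiscrete hPD.1,
      eventually_analyticAt_codiscrete hLD.1] with z h1 h2 h3 h4 hPa hLa
    rw [deriv_div hPa.differentiableAt hLa.differentiableAt h4]
    rw [h3, Pi.zero_apply, mul_zero] at h1
    rw [← h1] at h2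
    have h5 : deriv P z * L z - P z * deriv L z = 0 := by
      linear_combination (-L z) * h1 - P z * h2
    rw [h5, zero_div, Pi.zero_apply])
  refine hprop c ?_
  filter_upwards [hc, hL0] with z hz h4
  rw [Pi.div_apply, div_eq_iff h4] at hz
  exact hz
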